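/- For a finite group $G$, let $d(G)$ denote the minimal number of generators of $G$, and call $G$ *$d$-maximal* if $d(H)<d(G)$ for every proper subgroup $H<G$. **Theorem (Blackburn).** If $G$ is a finite $d$-maximal $2$-group with $d(G)=3$, then $G$ is isomorphic to one of the following groups: (a) the elementary abelian group $C_2\times C_2\times C_2$; (b) the direct product $C_2\times Q_8$, where $Q_8$ is the quaternion group of order $8$; (c) the central product $C_4\ast Q_8$, that is, the quotient of $C_4\times Q_8$ which identifies the involution of $C_4$ with the central involution of $Q_8$; (d) the group $$\langle a,b,c \mid a^4=b^4=[a,b]=1,\ c^2=a^2,\ a^c=ab^2,\ b^c=ba^2\rangle ,\qquad\text{where } x^c=c^{-1}xc.$$ Moreover, $C_4\ast Q_8$ is isomorphic to the central product $C_4\ast D_8$ (with $D_8$ the dihedral group of order $8$, its central involution being identified with the involution of $C_4$) and has order $2^4$, and the group in (d) has order $2^5$. -/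

import Mathlib

/-- A finite group `G` is `d`-maximal if `d(H) < d(G)` for every proper subgroup `H` of `G`, where
`d` denotes the minimal number of generators (`Group.rank`). -/
def IsDMaximal (G : Type*) [Group G] [Finite G] : Prop :=
  ∀ H : Subgroup G, H < ⊤ → Group.rank H < Group.rank G

/-- The cyclic group of order `n` (for `n ≠ 0`), written multiplicatively. -/
abbrev Cyc (n : ℕ) : Type := Multiplicative (ZMod n)

section CentralProduct

variable {A B : Type*} [Group A] [Group B]

/-- A central element `z` of `A`, a central element `w` of `B`, of the same order: the data needed
to amalgamate the central cyclic subgroups `⟨z⟩ ≤ A` and `⟨w⟩ ≤ B` along the isomorphism sending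
`z` to `w`. -/
structure CentralAmalgam (A B : Type*) [Group A] [Group B] where
  z : A
  w : B
  z_mem : z ∈ Subgroup.center A
  w_mem : w ∈ Subgroup.center B
  orderOf_eq : orderOf z = orderOf w

/-- The subgroup `{(z ^ k, w ^ (-k))}` of `A × B` that is factored out in the central product. -/
def CentralAmalgam.kernel (D : CentralAmalgam A B) : Subgroup (A × B) :=
  Subgroup.zpowers (D.z, D.w⁻¹)

instance CentralAmalgam.kernel_normal (D : CentralAmalgam A B) : D.kernel.Normal := by
  have h : D.kernel ≤ Subgroup.center (A × B) := by
    rw [CentralAmalgam.kernel, Subgroup.zpowers_le, Subgroup.mem_center_iff]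
    rintro ⟨g, h⟩
    exact Prod.ext (Subgroup.mem_center_iff.1 D.z_mem g)
      (Subgroup.mem_center_iff.1 (Subgroup.inv_mem _ D.w_mem) h)
  exact ⟨fun n hn g => by
    rw [Subgroup.mem_center_iff.1 (h hn) g, mul_inv_cancel_right]; exact hn⟩

/-- The (external) central product of `A` and `B` in which `z ∈ A` is identified with `w ∈ B`. -/
abbrev CentralProduct (D : CentralAmalgam A B) : Type _ := (A × B) ⧸ D.kernel

end CentralProduct

/-- The involution of `C₄` and the central involution `a²` of `Q₈ = QuaternionGroup 2`. -/
def amalgamC4Q8 : CentralAmalgam (Cyc 4) (QuaternionGroup 2) where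
  z := Multiplicative.ofAdd 2
  w := QuaternionGroup.a 2
  z_mem := Subgroup.mem_center_iff.2 fun g => mul_comm g _
  w_mem := Subgroup.mem_center_iff.2 (by decide)
  orderOf_eq := by
    rw [orderOf_eq_prime (p := 2) (by decide) (by decide),
      orderOf_eq_prime (p := 2) (by decide) (by decide)]

/-- The involution of `C₄` and the central involution `r²` of `D₈ = DihedralGroup 4` (the dihedral
group of order 8). -/
def amalgamC4D8 : CentralAmalgam (Cyc 4) (DihedralGroup 4) where
  z := Multiplicative.ofAdd 2
  w := DihedralGroup.r 2
  z_mem := Subgroup.mem_center_iff.2 fun g => mul_comm g _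
  w_mem := Subgroup.mem_center_iff.2 (by decide)
  orderOf_eq := by
    rw [orderOf_eq_prime (p := 2) (by decide) (by decide),
      orderOf_eq_prime (p := 2) (by decide) (by decide)]

/-- The central product `C₄ ∗ Q₈`. -/
abbrev C4Q8 : Type := CentralProduct amalgamC4Q8

/-- The central product `C₄ ∗ D₈`. -/
abbrev C4D8 : Type := CentralProduct amalgamC4D8

/-- The relators, in the generators `a = of 0`, `b = of 1`, `c = of 2`, of
`⟨a, b, c ∣ a⁴ = b⁴ = [a,b] = 1, c² = a², a^c = a b², b^c = b a²⟩`, where `x^c = c⁻¹ x c`. -/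
def blackburnRels : Set (FreeGroup (Fin 3)) :=
  let a : FreeGroup (Fin 3) := FreeGroup.of 0
  let b : FreeGroup (Fin 3) := FreeGroup.of 1
  let c : FreeGroup (Fin 3) := FreeGroup.of 2
  {a ^ 4, b ^ 4, a * b * a⁻¹ * b⁻¹, c ^ 2 * (a ^ 2)⁻¹,
    (c⁻¹ * a * c) * (a * b ^ 2)⁻¹, (c⁻¹ * b * c) * (b * a ^ 2)⁻¹}

/-- `⟨a, b, c ∣ a⁴ = b⁴ = [a,b] = 1, c² = a², a^c = a b², b^c = b a²⟩`. -/
abbrev BlackburnGroup : Type := PresentedGroup blackburnRels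

/-! Write Φ for the subgroup `squares G`, the Frattini subgroup of the finite 2-group G. The
hypotheses are used in the form `IsCritical`: three generators are needed, and proper subgroups need
at most two. This form passes to quotients by normal subgroups inside Φ, so induction on |Φ| is
available.

Two consequences drive the proof. A proper elementary abelian subgroup has order at most 4
(`IsCritical.card_le_four`). Any two members x, y of a generating triple satisfy Φ ≤ ⟨x, y⟩
(`squares_le_closure_pair`). Hence, if x and y become commuting elements of square 1 modulo a normal
N ≤ Φ, then Φ = N (`squares_le_of_sq_mem`).

If |Φ| = 2, commutators and squares take values in Φ, and a change of generators produces a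
quaternion pair and a third generator w commuting with it; w² decides between C₂ × Q₈ and C₄ ∗ Q₈.
If |Φ| = 4, then Φ is central of exponent 2, commutators are bilinear, and normalising generators
leaves only the relations of (d). If |Φ| = 8, lifting those relations through a central involution
makes Φ elementary abelian of order 8, a contradiction; since quotients halve |Φ|, no larger order
occurs.

Finally |G| ≥ 8|Φ|, while each model group has exactly the matching order and maps onto G. -/

namespace ThreeGenerated

/-- The subgroup generated by all squares; in a finite `2`-group it is the Frattini subgroup. -/
def squares (G : Type*) [Group G] : Subgroup G :=
  Subgroup.closure (Set.range fun g : G => g ^ 2)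

/-! ### The subgroup generated by squares -/

section Squares

variable {G H : Type*} [Group G] [Group H]

theorem sq_mem_squares (g : G) : g ^ 2 ∈ squares G :=
  Subgroup.subset_closure ⟨g, rfl⟩

theorem squares_le {K : Subgroup G} (h : ∀ g, g ^ 2 ∈ K) : squares G ≤ K :=
  (Subgroup.closure_le K).2 (by rintro _ ⟨g, rfl⟩; exact h g)

/-- A commutator is a product of three squares; normality of `squares G` follows from this. -/
theorem commutator_mem_squares (x y : G) : x * y * x⁻¹ * y⁻¹ ∈ squares G := by
  have h : x * y * x⁻¹ * y⁻¹ = (x * y) ^ 2 * (y⁻¹ * x⁻¹ * y) ^ 2 * y⁻¹ ^ 2 := by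
    simp [pow_two, mul_assoc]
  rw [h]
  exact mul_mem (mul_mem (sq_mem_squares _) (sq_mem_squares _)) (sq_mem_squares _)

instance squares_normal : (squares G).Normal :=
  ⟨fun n hn g => by
    have h := mul_mem (commutator_mem_squares g n) hn
    rwa [inv_mul_cancel_right] at h⟩

theorem map_squares {φ : G →* H} (hφ : Function.Surjective φ) :
    (squares G).map φ = squares H := by
  rw [squares, squares, MonoidHom.map_closure, ← Set.range_comp]
  congr 1
  ext h
  constructor
  · rintro ⟨g, rfl⟩
    exact ⟨φ g, by simp⟩
  · rintro ⟨g, rfl⟩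
    obtain ⟨g, rfl⟩ := hφ g
    exact ⟨g, by simp⟩

theorem sq_eq_one_of_quotient_squares (g : G ⧸ squares G) : g ^ 2 = 1 := by
  obtain ⟨g, rfl⟩ := QuotientGroup.mk_surjective g
  rw [← QuotientGroup.mk_pow, QuotientGroup.eq_one_iff]
  exact sq_mem_squares g

/-- Squares are non-generators in a finite `2`-group. -/
theorem eq_top_of_sup_squares [Finite G] (hG : IsPGroup 2 G) {L : Subgroup G}
    (h : L ⊔ squares G = ⊤) : L = ⊤ := by
  by_contra hL
  obtain ⟨n, hn⟩ := IsPGroup.iff_card.1 hG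
  obtain ⟨m, hm⟩ := IsPGroup.iff_card.1 (hG.to_subgroup L)
  have hmn : m < n := by
    have h1 : Nat.card L < Nat.card G :=
      lt_of_le_of_ne (Subgroup.card_le_card_group L) fun h => hL (Subgroup.eq_top_of_card_eq L h)
    rw [hn, hm] at h1
    exact (Nat.pow_lt_pow_iff_right (by norm_num)).1 h1
  obtain ⟨k, rfl⟩ : ∃ k, n = k + 1 := ⟨n - 1, by omega⟩
  obtain ⟨K, hK, hLK⟩ := Sylow.exists_subgroup_card_pow_prime_le 2 (m := k)
    (by rw [hn]; exact pow_dvd_pow 2 k.le_succ) L hm (by omega)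
  -- A proper L lies in some K of index 2, and a subgroup of index 2 contains every square.
  have hi : K.index = 2 := by
    have h1 := K.card_mul_index
    rw [hK, hn, pow_succ] at h1
    exact Nat.eq_of_mul_eq_mul_left (by positivity) h1
  have hT : K = ⊤ := top_le_iff.1 (h ▸ sup_le hLK (squares_le (Subgroup.sq_mem_of_index_two hi)))
  rw [hT, Subgroup.index_top] at hi
  omega

end Squares

/-! ### Linear dependence in groups of exponent two -/

section ExponentTwo

variable {Q : Type*} [Group Q]

theorem mul_comm_of_exponent_two (hQ : ∀ g : Q, g ^ 2 = 1) (a b : Q) : a * b = b * a := by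
  have h := hQ (a * b)
  have ha := hQ a
  have hb := hQ b
  rw [pow_two] at h ha hb
  calc a * b = a * (a * b * (a * b)) * b := by rw [h]; simp
    _ = (a * a) * (b * a) * (b * b) := by group
    _ = b * a := by rw [ha, hb, one_mul, mul_one]

theorem mem_closure_pair_of_sq {u v g : Q} (hu : u ^ 2 = 1) (hv : v ^ 2 = 1)
    (huv : u * v = v * u) (hg : g ∈ Subgroup.closure {u, v}) :
    g = 1 ∨ g = u ∨ g = v ∨ g = u * v := by
  rw [pow_two] at hu hv
  have hu' : ∀ g, u * (u * g) = g := fun g => by rw [← mul_assoc, hu, one_mul]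
  have hv' : ∀ g, v * (v * g) = g := fun g => by rw [← mul_assoc, hv, one_mul]
  have key : ∀ w ∈ ({u, v} : Set Q), ∀ g : Q, g = 1 ∨ g = u ∨ g = v ∨ g = u * v →
      w * g = 1 ∨ w * g = u ∨ w * g = v ∨ w * g = u * v := by
    rintro w (rfl | rfl) g (rfl | rfl | rfl | rfl)
    · simp
    · simp [hu]
    · simp
    · simp [hu']
    · simp
    · simp [huv]
    · simp [hv]
    · simp [huv, hv']
  induction hg using Subgroup.closure_induction_left with
  | one => exact Or.inl rfl
  | mul_left w hw g _ ih => exact key w hw g ih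
  | inv_mul_cancel w hw g _ ih =>
    have hw' : w⁻¹ = w := by
      rcases hw with rfl | rfl
      · exact inv_eq_of_mul_eq_one_left hu
      · exact inv_eq_of_mul_eq_one_left hv
    rw [hw']
    exact key w hw g ih

theorem card_le_four_of_closure_pair (hQ : ∀ g : Q, g ^ 2 = 1) {u v : Q}
    (h : Subgroup.closure {u, v} = ⊤) : Nat.card Q ≤ 4 := by
  classical
  have hs : (Set.univ : Set Q) ⊆ (({1, u, v, u * v} : Finset Q) : Set Q) := fun g _ => by
    have h1 := mem_closure_pair_of_sq (hQ u) (hQ v) (mul_comm_of_exponent_two hQ u v)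
      (h ▸ Subgroup.mem_top g)
    simpa using h1
  rw [← Set.ncard_univ]
  exact (Set.ncard_le_ncard hs (Finset.finite_toSet _)).trans
    ((Set.ncard_coe_finset _).trans_le Finset.card_le_four)

/-- Three elements of an elementary abelian group of order at most four are dependent. -/
theorem dependent_of_card_le_four [Finite Q] (hQ : ∀ g : Q, g ^ 2 = 1) (h4 : Nat.card Q ≤ 4)
    (a b c : Q) : a = 1 ∨ b = 1 ∨ c = 1 ∨ a * b = 1 ∨ c = a ∨ c = b ∨ c = a * b := by
  classical
  by_contra! h
  obtain ⟨h1, h2, h3, h5, h6, h7, h8⟩ := h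
  have hab : a ≠ b := by
    rintro rfl
    exact h5 (by rw [← pow_two, hQ])
  have h9 : ({1, a, b, a * b, c} : Finset Q).card = 5 := by
    rw [Finset.card_insert_of_notMem, Finset.card_insert_of_notMem, Finset.card_insert_of_notMem,
      Finset.card_insert_of_notMem, Finset.card_singleton] <;>
    simp [h1.symm, h2.symm, h3.symm, h5.symm, h6.symm, h7.symm, h8.symm, hab, h1, h2]
  have h10 := Set.ncard_le_card (({1, a, b, a * b, c} : Finset Q) : Set Q)
  rw [Set.ncard_coe_finset] at h10
  omega

end ExponentTwo

/-! ### Generating triples and their elementary transformations -/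

section Triple

variable {G : Type*} [Group G]

/-- The elements `x`, `y`, `w` generate the group. -/
def GeneratingTriple (x y w : G) : Prop :=
  Subgroup.closure {x, y, w} = ⊤

theorem GeneratingTriple.le {x y w : G} (h : GeneratingTriple x y w) {K : Subgroup G}
    (hx : x ∈ K) (hy : y ∈ K) (hw : w ∈ K) : K = ⊤ := by
  rw [← top_le_iff, ← h, Subgroup.closure_le]
  rintro g (rfl | rfl | rfl) <;> assumption

theorem GeneratingTriple.of_mem {x y w x' y' w' : G} (h : GeneratingTriple x y w)
    (hx : x ∈ Subgroup.closure {x', y', w'}) (hy : y ∈ Subgroup.closure {x', y', w'})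
    (hw : w ∈ Subgroup.closure {x', y', w'}) : GeneratingTriple x' y' w' :=
  h.le hx hy hw

theorem mem_closure_triple (x y w : G) : x ∈ Subgroup.closure {x, y, w} ∧
    y ∈ Subgroup.closure {x, y, w} ∧ w ∈ Subgroup.closure {x, y, w} :=
  ⟨Subgroup.subset_closure (by simp), Subgroup.subset_closure (by simp),
    Subgroup.subset_closure (by simp)⟩

theorem GeneratingTriple.swap {x y w : G} (h : GeneratingTriple x y w) :
    GeneratingTriple y x w :=
  have ⟨h1, h2, h3⟩ := mem_closure_triple y x w
  h.of_mem h2 h1 h3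

theorem GeneratingTriple.rotate {x y w : G} (h : GeneratingTriple x y w) :
    GeneratingTriple y w x :=
  have ⟨h1, h2, h3⟩ := mem_closure_triple y w x
  h.of_mem h3 h1 h2

theorem GeneratingTriple.mul {x y w : G} (h : GeneratingTriple x y w) :
    GeneratingTriple (x * y) y w :=
  have ⟨h1, h2, h3⟩ := mem_closure_triple (x * y) y w
  h.of_mem ((Subgroup.mul_mem_cancel_right _ h2).1 h1) h2 h3

theorem GeneratingTriple.mul_right {x y w : G} (h : GeneratingTriple x y w) :
    GeneratingTriple (x * w) y w :=
  h.rotate.rotate.swap.mul.swap.rotate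

/-- Elements commuting with a generating triple are central. -/
theorem GeneratingTriple.mem_center {x y w g : G} (h : GeneratingTriple x y w)
    (hx : Commute x g) (hy : Commute y g) (hw : Commute w g) : g ∈ Subgroup.center G := by
  have := h.le (K := Subgroup.centralizer {g})
    (Subgroup.mem_centralizer_singleton_iff.2 hx.eq) (Subgroup.mem_centralizer_singleton_iff.2 hy.eq)
    (Subgroup.mem_centralizer_singleton_iff.2 hw.eq)
  rw [Subgroup.mem_center_iff]
  intro k
  exact Subgroup.mem_centralizer_singleton_iff.1 (this ▸ Subgroup.mem_top k)

theorem closure_sup_eq_top_of_mk {N : Subgroup G} [N.Normal] {S : Set G}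
    (h : Subgroup.closure ((QuotientGroup.mk : G → G ⧸ N) '' S) = ⊤) :
    Subgroup.closure S ⊔ N = ⊤ := by
  have h1 := (MonoidHom.map_closure (QuotientGroup.mk' N) S).trans h
  have h2 := Subgroup.comap_map_eq (QuotientGroup.mk' N) (Subgroup.closure S)
  rw [h1, Subgroup.comap_top, QuotientGroup.ker_mk'] at h2
  exact h2.symm

theorem GeneratingTriple.mk {x y w : G} (h : GeneratingTriple x y w) (N : Subgroup G)
    [N.Normal] : GeneratingTriple (x : G ⧸ N) y w := by
  have h1 := MonoidHom.map_closure (QuotientGroup.mk' N) {x, y, w}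
  rw [h, ← MonoidHom.range_eq_map, QuotientGroup.range_mk'] at h1
  rw [GeneratingTriple, h1]
  simp [Set.image_insert_eq]

end Triple

/-! ### Critical groups: quotients and the position of the Frattini subgroup -/

/-- A finite `2`-group which needs three generators and all of whose proper subgroups can be
generated by two elements. -/
structure IsCritical (G : Type*) [Group G] : Prop where
  isPGroup : IsPGroup 2 G
  exists_triple : ∃ x y w : G, GeneratingTriple x y w
  closure_pair_ne_top : ∀ x y : G, Subgroup.closure {x, y} ≠ ⊤
  exists_pair : ∀ H : Subgroup G, H ≠ ⊤ → ∃ x y : G, Subgroup.closure {x, y} = H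

namespace IsCritical

variable {G : Type*} [Group G]

/-- A proper elementary abelian subgroup has order at most four. -/
theorem card_le_four (hG : IsCritical G) {H : Subgroup G} (hH : H ≠ ⊤)
    (h2 : ∀ g ∈ H, g ^ 2 = 1) : Nat.card H ≤ 4 := by
  obtain ⟨u, v, rfl⟩ := hG.exists_pair H hH
  refine card_le_four_of_closure_pair (fun g => Subtype.ext (h2 g g.2))
    (u := ⟨u, Subgroup.subset_closure (by simp)⟩) (v := ⟨v, Subgroup.subset_closure (by simp)⟩) ?_
  apply Subgroup.map_injective (Subgroup.subtype_injective _)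
  rw [MonoidHom.map_closure, Set.image_pair, ← MonoidHom.range_eq_map, Subgroup.range_subtype]
  rfl

variable [Finite G]

theorem closure_pair_sup_ne_top (hG : IsCritical G) (x y : G) :
    Subgroup.closure {x, y} ⊔ squares G ≠ ⊤ :=
  fun h => hG.closure_pair_ne_top x y (eq_top_of_sup_squares hG.isPGroup h)

theorem notMem_squares (hG : IsCritical G) {x y w : G} (h : GeneratingTriple x y w) :
    x ∉ squares G := fun hx =>
  hG.closure_pair_sup_ne_top y w <| h.le (le_sup_right (a := Subgroup.closure {y, w}) hx)
    (le_sup_left (b := squares G) (Subgroup.subset_closure (by simp)))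
    (le_sup_left (b := squares G) (Subgroup.subset_closure (by simp)))

/-- Factoring out non-generators does not lower the number of generators, and proper subgroups pull
back to proper subgroups. This is what makes induction on the order of `squares G` possible. -/
theorem quotient (hG : IsCritical G) {N : Subgroup G} [N.Normal] (hN : N ≤ squares G) :
    IsCritical (G ⧸ N) where
  isPGroup := hG.isPGroup.to_quotient N
  exists_triple := by
    obtain ⟨x, y, w, h⟩ := hG.exists_triple
    exact ⟨x, y, w, h.mk N⟩
  closure_pair_ne_top x y h := by
    obtain ⟨x, rfl⟩ := QuotientGroup.mk_surjective x
    obtain ⟨y, rfl⟩ := QuotientGroup.mk_surjective y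
    rw [← Set.image_pair] at h
    refine hG.closure_pair_sup_ne_top x y (top_le_iff.1 ?_)
    rw [← closure_sup_eq_top_of_mk h]
    exact sup_le_sup_left hN _
  exists_pair H hH := by
    obtain ⟨x, y, h⟩ := hG.exists_pair (H.comap (QuotientGroup.mk' N)) fun h => hH <| by
      rw [← Subgroup.map_comap_eq_self_of_surjective (QuotientGroup.mk'_surjective N) H, h,
        ← MonoidHom.range_eq_map, QuotientGroup.range_mk']
    refine ⟨x, y, ?_⟩
    rw [← Subgroup.map_comap_eq_self_of_surjective (QuotientGroup.mk'_surjective N) H, ← h,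
      MonoidHom.map_closure, Set.image_pair]
    rfl

/-- Generating triples lift along quotients by subgroups generated by squares. -/
theorem lift_triple (hG : IsCritical G) {N : Subgroup G} [N.Normal] (hN : N ≤ squares G)
    {x y w : G} (h : GeneratingTriple (x : G ⧸ N) y w) : GeneratingTriple x y w := by
  have h' : Subgroup.closure ((QuotientGroup.mk : G → G ⧸ N) '' {x, y, w}) = ⊤ := by
    rw [← h]
    simp [Set.image_insert_eq]
  refine eq_top_of_sup_squares hG.isPGroup (top_le_iff.1 ?_)
  rw [← closure_sup_eq_top_of_mk h']
  exact sup_le_sup_left hN _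

/-- Any two members of a generating triple generate a subgroup containing all squares. -/
theorem squares_le_closure_pair (hG : IsCritical G) {x y w : G} (h : GeneratingTriple x y w) :
    squares G ≤ Subgroup.closure {x, y} := by
  -- K is proper, hence 2-generated, so K/Φ(K) has order at most 4. Since Φ(K) ≤ Φ(G), the images of
  -- x and y there stay independent. Dependence of x, y, f for f ∈ Φ(G) then forces f ∈ Φ(K), whence
  -- K = ⟨x, y⟩Φ(K) = ⟨x, y⟩.
  set K := Subgroup.closure {x, y} ⊔ squares G with hK
  have hxK : x ∈ K := le_sup_left (b := squares G) (Subgroup.subset_closure (by simp))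
  have hyK : y ∈ K := le_sup_left (b := squares G) (Subgroup.subset_closure (by simp))
  have hFK : squares G ≤ K := le_sup_right
  have hle : (squares K).map K.subtype ≤ squares G := by
    rw [Subgroup.map_le_iff_le_comap]
    exact squares_le fun g => sq_mem_squares (g : G)
  obtain ⟨u, v, huv⟩ := hG.exists_pair K (hG.closure_pair_sup_ne_top x y)
  have huK : u ∈ K := huv ▸ Subgroup.subset_closure (by simp)
  have hvK : v ∈ K := huv ▸ Subgroup.subset_closure (by simp)
  have hK2 : Subgroup.closure {(⟨u, huK⟩ : K), ⟨v, hvK⟩} = ⊤ := by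
    apply Subgroup.map_injective K.subtype_injective
    rw [MonoidHom.map_closure, Set.image_pair, ← MonoidHom.range_eq_map, Subgroup.range_subtype]
    exact huv
  have h4 : Nat.card (K ⧸ squares K) ≤ 4 := by
    refine card_le_four_of_closure_pair sq_eq_one_of_quotient_squares
      (u := ((⟨u, huK⟩ : K) : K ⧸ squares K)) (v := ((⟨v, hvK⟩ : K) : K ⧸ squares K)) ?_
    have h1 := MonoidHom.map_closure (QuotientGroup.mk' (squares K)) {(⟨u, huK⟩ : K), ⟨v, hvK⟩}
    rw [hK2, ← MonoidHom.range_eq_map, QuotientGroup.range_mk', Set.image_pair] at h1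
    exact h1.symm
  have hmem : ∀ k : K, (k : K ⧸ squares K) = 1 → (k : G) ∈ squares G := fun k hk =>
    hle ⟨k, (QuotientGroup.eq_one_iff k).1 hk, rfl⟩
  have hmem2 : ∀ k l : K, (k : G) ∈ squares G → (k : K ⧸ squares K) = l →
      (l : G) ∈ squares G := fun k l hk hkl =>
    (Subgroup.mul_mem_cancel_left _ (inv_mem hk)).1
      (hle ⟨_, QuotientGroup.eq.1 hkl, rfl⟩)
  have hsq : ∀ f (hf : f ∈ squares G), (⟨f, hFK hf⟩ : K) ∈ squares K := by
    intro f hf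
    rcases dependent_of_card_le_four sq_eq_one_of_quotient_squares h4
      ((⟨x, hxK⟩ : K) : K ⧸ squares K) ((⟨y, hyK⟩ : K) : K ⧸ squares K)
      ((⟨f, hFK hf⟩ : K) : K ⧸ squares K) with h1 | h1 | h1 | h1 | h1 | h1 | h1
    · exact absurd (hmem _ h1) (hG.notMem_squares h)
    · exact absurd (hmem _ h1) (hG.notMem_squares h.swap)
    · exact (QuotientGroup.eq_one_iff _).1 h1
    · exact absurd (hmem _ h1) (hG.notMem_squares h.mul)
    · exact absurd (hmem2 _ _ hf h1) (hG.notMem_squares h)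
    · exact absurd (hmem2 _ _ hf h1) (hG.notMem_squares h.swap)
    · exact absurd (hmem2 _ _ hf h1) (hG.notMem_squares h.mul)
  have hF : (Subgroup.closure {x, y}).subgroupOf K = ⊤ := by
    refine eq_top_of_sup_squares (hG.isPGroup.to_subgroup K) (top_le_iff.1 ?_)
    rintro ⟨k, hk⟩ -
    obtain ⟨p, hp, f, hf, rfl⟩ := Subgroup.mem_sup_of_normal_right.1 hk
    exact Subgroup.mul_mem_sup (S := (Subgroup.closure {x, y}).subgroupOf K)
      (x := ⟨p, le_sup_left (b := squares G) hp⟩) (y := ⟨f, hFK hf⟩)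
      hp (hsq f hf)
  exact hFK.trans (Subgroup.subgroupOf_eq_top.1 hF)

/-- If two members of a generating triple commute and square to `1` modulo `N`, then `N` contains
all squares. -/
theorem squares_le_of_sq_mem (hG : IsCritical G) {x y w : G} (h : GeneratingTriple x y w)
    {N : Subgroup G} [N.Normal] (hN : N ≤ squares G) (hx : x ^ 2 ∈ N) (hy : y ^ 2 ∈ N)
    (hxy : x * y * x⁻¹ * y⁻¹ ∈ N) : squares G ≤ N := by
  intro f hf
  have hx' : (x : G ⧸ N) ^ 2 = 1 := (QuotientGroup.eq_one_iff (x ^ 2)).2 hx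
  have hy' : (y : G ⧸ N) ^ 2 = 1 := (QuotientGroup.eq_one_iff (y ^ 2)).2 hy
  have hxy' : (x : G ⧸ N) * y = y * x := by
    have h1 : (x : G ⧸ N) * y * (x : G ⧸ N)⁻¹ * (y : G ⧸ N)⁻¹ = 1 :=
      (QuotientGroup.eq_one_iff (x * y * x⁻¹ * y⁻¹)).2 hxy
    rw [mul_inv_eq_one, mul_inv_eq_iff_eq_mul] at h1
    exact h1
  have hmem : (f : G ⧸ N) ∈ Subgroup.closure {(x : G ⧸ N), (y : G ⧸ N)} := by
    have h1 := Subgroup.mem_map_of_mem (QuotientGroup.mk' N) (hG.squares_le_closure_pair h hf)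
    rw [MonoidHom.map_closure, Set.image_pair] at h1
    exact h1
  -- The image of f is one of 1, x, y, xy modulo N, and the last three lie outside `squares G`.
  have key : ∀ k : G, (f : G ⧸ N) = k → k ∈ squares G := fun k hk =>
    (Subgroup.mul_mem_cancel_left _ (inv_mem hf)).1 (hN (QuotientGroup.eq.1 hk))
  rcases mem_closure_pair_of_sq hx' hy' hxy' hmem with h1 | h1 | h1 | h1
  · exact (QuotientGroup.eq_one_iff f).1 h1
  · exact absurd (key _ h1) (hG.notMem_squares h)
  · exact absurd (key _ h1) (hG.notMem_squares h.swap)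
  · exact absurd (key _ h1) (hG.notMem_squares h.mul)

theorem squares_ne_top (hG : IsCritical G) : squares G ≠ ⊤ := fun h => by
  obtain ⟨x, y, w, hx⟩ := hG.exists_triple
  exact hG.notMem_squares hx (h ▸ Subgroup.mem_top x)

/-- A generating triple is independent modulo `squares G`, so the index, a power of 2, exceeds 4.
This bound lets the recognition lemmas conclude by counting. -/
theorem eight_mul_card_squares_le (hG : IsCritical G) :
    8 * Nat.card (squares G) ≤ Nat.card G := by
  obtain ⟨x, y, w, h⟩ := hG.exists_triple
  have h4 : ¬ Nat.card (G ⧸ squares G) ≤ 4 := by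
    intro h4
    have hs := sq_eq_one_of_quotient_squares (G := G)
    have key : ∀ k : G, (k : G ⧸ squares G) = 1 → k ∈ squares G :=
      fun k => (QuotientGroup.eq_one_iff k).1
    rcases dependent_of_card_le_four hs h4 (x : G ⧸ squares G) y w with
      h1 | h1 | h1 | h1 | h1 | h1 | h1
    · exact hG.notMem_squares h (key _ h1)
    · exact hG.notMem_squares h.swap (key _ h1)
    · exact hG.notMem_squares h.rotate.rotate (key _ h1)
    · exact hG.notMem_squares h.mul (key _ h1)
    · refine hG.notMem_squares h.mul_right (key _ ?_)
      rw [QuotientGroup.mk_mul, h1, ← pow_two, hs]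
    · refine hG.notMem_squares h.rotate.mul (key _ ?_)
      rw [QuotientGroup.mk_mul, h1, ← pow_two, hs]
    · refine hG.notMem_squares h.mul.mul_right (key _ ?_)
      rw [QuotientGroup.mk_mul, h1, QuotientGroup.mk_mul, ← pow_two, hs]
  obtain ⟨n, hn⟩ := hG.isPGroup.index (squares G)
  have h8 : 8 ≤ (squares G).index := by
    rw [Subgroup.index_eq_card] at hn ⊢
    rw [hn] at h4 ⊢
    have h3 : 3 ≤ n := by
      by_contra hn3
      exact h4 ((Nat.pow_le_pow_right (by norm_num) (by omega : n ≤ 2)).trans (by norm_num))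
    exact (by norm_num : 8 = 2 ^ 3).trans_le (Nat.pow_le_pow_right (by norm_num) h3)
  rw [← (squares G).card_mul_index, mul_comm]
  exact Nat.mul_le_mul_left _ h8

/-- A nontrivial Frattini subgroup contains a central involution. -/
theorem exists_central_involution (hG : IsCritical G) (h : squares G ≠ ⊥) :
    ∃ z ∈ squares G, z ∈ Subgroup.center G ∧ z ≠ 1 ∧ z ^ 2 = 1 := by
  have hP : IsPGroup 2 (ConjAct G) := hG.isPGroup.of_equiv ConjAct.toConjAct
  have hdvd : 2 ∣ Nat.card (squares G) := by
    obtain h1 | h1 := (hG.isPGroup.to_subgroup (squares G)).card_eq_or_dvd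
    · exact absurd (Subgroup.eq_bot_of_card_eq _ h1) h
    · exact h1
  -- For conjugation on `squares G` the number of fixed points is even and 1 is one of them. A
  -- suitable power of another fixed point is the involution.
  obtain ⟨b, hb, hb1⟩ := hP.exists_fixed_point_of_prime_dvd_card_of_fixed_point (squares G) hdvd
    (a := 1) (by simp [MulAction.mem_fixedPoints])
  have hbc : (b : G) ∈ Subgroup.center G := by
    rw [Subgroup.mem_center_iff]
    intro g
    have h1 := congrArg Subtype.val (MulAction.mem_fixedPoints.1 hb (ConjAct.toConjAct g))
    rw [ConjAct.Subgroup.val_conj_smul, ConjAct.toConjAct_smul] at h1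
    exact mul_inv_eq_iff_eq_mul.1 h1
  have hb1' : (b : G) ≠ 1 := fun h => hb1 (Subtype.ext h.symm)
  obtain ⟨k, hk⟩ := (IsPGroup.iff_orderOf.1 hG.isPGroup) (b : G)
  obtain _ | k := k
  · exact absurd (orderOf_eq_one_iff.1 (by simpa using hk)) hb1'
  refine ⟨(b : G) ^ 2 ^ k, pow_mem b.2 _, pow_mem hbc _, ?_, ?_⟩
  · exact pow_ne_one_of_lt_orderOf (by positivity)
      (by rw [hk]; exact Nat.pow_lt_pow_right (by norm_num) k.lt_succ_self)
  · rw [← pow_mul, ← pow_succ, ← hk, pow_orderOf_eq_one]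

end IsCritical

/-! ### Calculus of central commutators -/

section CommutatorRelation

variable {G : Type*} [Group G]

/-- The commutator of `u` and `v` is the central element `s`. -/
def CommutesUpTo (s u v : G) : Prop :=
  s ∈ Subgroup.center G ∧ u * v = s * (v * u)

/-- Central commutators are multiplicative in each argument, which turns the later changes of
generators into linear algebra over 𝔽₂. -/
theorem CommutesUpTo.mul_right {s t u v w : G} (h : CommutesUpTo s u v)
    (h' : CommutesUpTo t u w) : CommutesUpTo (s * t) u (v * w) := by
  refine ⟨mul_mem h.1 h'.1, ?_⟩
  calc u * (v * w) = s * (v * (u * w)) := by rw [← mul_assoc, h.2]; simp only [mul_assoc]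
    _ = s * (v * t * (w * u)) := by rw [h'.2]; simp only [mul_assoc]
    _ = s * t * (v * w * u) := by
      rw [Subgroup.mem_center_iff.1 h'.1 v]; simp only [mul_assoc]

theorem CommutesUpTo.symm {s u v : G} (h : CommutesUpTo s u v) : CommutesUpTo s⁻¹ v u :=
  ⟨inv_mem h.1, by rw [h.2, inv_mul_cancel_left]⟩

theorem CommutesUpTo.mul_left {s t u v w : G} (h : CommutesUpTo s u w)
    (h' : CommutesUpTo t v w) : CommutesUpTo (s * t) (u * v) w := by
  have h1 := (h.symm.mul_right h'.symm).symm
  rwa [← mul_inv_rev, inv_inv, Subgroup.mem_center_iff.1 h.1 t] at h1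

theorem commutesUpTo_one {u v : G} : CommutesUpTo 1 u v ↔ Commute u v :=
  ⟨fun h => h.2.trans (one_mul _), fun h => ⟨one_mem _, h.eq.trans (one_mul _).symm⟩⟩

theorem CommutesUpTo.self (u : G) : CommutesUpTo 1 u u :=
  commutesUpTo_one.2 (Commute.refl u)

theorem CommutesUpTo.mul_sq {s u v : G} (h : CommutesUpTo s v u) :
    (u * v) ^ 2 = s * (u ^ 2 * v ^ 2) := by
  calc (u * v) ^ 2 = u * (v * u) * v := by simp only [pow_two, mul_assoc]
    _ = (u * s) * u * v * v := by rw [h.2]; simp only [mul_assoc]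
    _ = s * (u ^ 2 * v ^ 2) := by
      rw [Subgroup.mem_center_iff.1 h.1 u]; simp only [pow_two, mul_assoc]

theorem CommutesUpTo.commute_sq {s u v : G} (h : CommutesUpTo s u v) (hs : s ^ 2 = 1) :
    Commute (u ^ 2) v := by
  have h1 := h.mul_left h
  rwa [← pow_two, hs, ← pow_two, commutesUpTo_one] at h1

theorem CommutesUpTo.commutator_mem {s u v : G} (h : CommutesUpTo s u v) {N : Subgroup G}
    (hs : s ∈ N) : u * v * u⁻¹ * v⁻¹ ∈ N := by
  rw [h.2]
  simpa [mul_assoc] using hs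

theorem commutesUpTo_commutator (h : squares G ≤ Subgroup.center G) (u v : G) :
    CommutesUpTo (u * v * u⁻¹ * v⁻¹) u v :=
  ⟨h (commutator_mem_squares u v), by group⟩

end CommutatorRelation

/-! ### Factoring out a central involution -/

section CentralInvolution

variable {G : Type*} [Group G]

theorem normal_zpowers_of_mem_center {z : G} (hz : z ∈ Subgroup.center G) :
    (Subgroup.zpowers z).Normal := by
  refine ⟨fun n hn g => ?_⟩
  have h : n ∈ Subgroup.center G := (Subgroup.zpowers_le.2 hz) hn
  rwa [Subgroup.mem_center_iff.1 h g, mul_inv_cancel_right]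

theorem mem_zpowers_of_sq_eq_one {z g : G} (hz : z ^ 2 = 1) (hg : g ∈ Subgroup.zpowers z) :
    g = 1 ∨ g = z := by
  rw [Subgroup.zpowers_eq_closure, ← Set.pair_eq_singleton] at hg
  rcases mem_closure_pair_of_sq hz hz rfl hg with h | h | h | h
  · exact Or.inl h
  · exact Or.inr h
  · exact Or.inr h
  · exact Or.inl (by rw [h, ← pow_two, hz])

/-- Relations found in the quotient by ⟨z⟩ lift to G up to a central factor of square 1. -/
theorem exists_eq_mul_of_mk_eq {z u v : G} (hz : z ∈ Subgroup.center G) (hz2 : z ^ 2 = 1)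
    (h : (u : G ⧸ Subgroup.zpowers z) = v) :
    ∃ s ∈ Subgroup.center G, s ^ 2 = 1 ∧ s ∈ Subgroup.zpowers z ∧ u = s * v := by
  have h1 := QuotientGroup.eq.1 h.symm
  have hc : v⁻¹ * u ∈ Subgroup.center G := (Subgroup.zpowers_le.2 hz) h1
  refine ⟨v⁻¹ * u, hc, ?_, h1, ?_⟩
  · rcases mem_zpowers_of_sq_eq_one hz2 h1 with h2 | h2 <;> rw [h2]
    · exact one_pow 2
    · exact hz2
  · rw [← Subgroup.mem_center_iff.1 hc v, mul_inv_cancel_left]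

theorem eq_one_or_eq_of_card_two {F : Subgroup G} (hF : Nat.card F = 2) {f : G} (hf : f ∈ F)
    (hf1 : f ≠ 1) {g : G} (hg : g ∈ F) : g = 1 ∨ g = f := by
  by_contra! h
  have hfin : Finite F := Nat.finite_of_card_ne_zero (by omega)
  have h1 := Set.ncard_le_ncard (t := (F : Set G)) (s := {1, f, g}) (by
    rintro k (rfl | rfl | rfl)
    exacts [one_mem _, hf, hg]) (Set.toFinite _)
  have h2 : ({1, f, g} : Set G).ncard = 3 := Set.ncard_eq_three.2
    ⟨1, f, g, hf1.symm, h.1.symm, h.2.symm, rfl⟩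
  rw [h2, ← Nat.card_coe_set_eq] at h1
  change 3 ≤ Nat.card F at h1
  omega

theorem card_squares_quotient [Finite G] {z : G} (hz : z ∈ squares G) (hz1 : z ≠ 1)
    (hz2 : z ^ 2 = 1) [(Subgroup.zpowers z).Normal] :
    Nat.card (squares G) = 2 * Nat.card (squares (G ⧸ Subgroup.zpowers z)) := by
  have hs := QuotientGroup.mk'_surjective (Subgroup.zpowers z)
  have hi := Subgroup.index_map (squares G) (QuotientGroup.mk' (Subgroup.zpowers z))
  rw [map_squares hs, QuotientGroup.ker_mk', QuotientGroup.range_mk', Subgroup.index_top, mul_one,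
    sup_eq_left.2 (Subgroup.zpowers_le.2 hz)] at hi
  have h1 := (squares G).card_mul_index
  have h2 := (squares (G ⧸ Subgroup.zpowers z)).card_mul_index
  have h3 := Subgroup.card_eq_card_quotient_mul_card_subgroup (Subgroup.zpowers z)
  rw [Nat.card_zpowers, orderOf_eq_prime hz2 hz1, ← h2, hi, ← h1] at h3
  have h4 : 0 < (squares G).index := Nat.pos_of_ne_zero Subgroup.index_ne_zero_of_finite
  exact Nat.eq_of_mul_eq_mul_right h4 (by rw [h3]; ring)

end CentralInvolution

/-! ### Frattini subgroup of order two, and centrality in order four -/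

namespace IsCritical

variable {G : Type*} [Group G] [Finite G]

/-- If the squares generate a subgroup of order two, then the group is not commutative. -/
theorem not_commute_of_card_two (hG : IsCritical G) (h2 : Nat.card (squares G) = 2) {x y w : G}
    (h : GeneratingTriple x y w) (hxy : Commute x y) (hxw : Commute x w) (hyw : Commute y w) :
    False := by
  obtain ⟨f, hf, -, hf1, hf2⟩ := hG.exists_central_involution fun hb => by simp [hb] at h2
  have hsq : ∀ g : G, g ^ 2 = 1 ∨ g ^ 2 = f :=
    fun g => eq_one_or_eq_of_card_two h2 hf hf1 (sq_mem_squares g)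
  have hmul : ∀ {u v : G}, Commute u v → u ^ 2 = f → v ^ 2 = f → (u * v) ^ 2 = 1 :=
    fun huv hu hv => by rw [huv.mul_pow, hu, hv, ← pow_two, hf2]
  have key : ∀ {u v w : G}, GeneratingTriple u v w → Commute u v → u ^ 2 = 1 → v ^ 2 = 1 →
      False := fun h huv hu hv => by
    have h1 := hG.squares_le_of_sq_mem h (N := ⊥) bot_le (Subgroup.mem_bot.2 hu)
      (Subgroup.mem_bot.2 hv) (Subgroup.mem_bot.2 (by simp [huv.eq]))
    exact hf1 (Subgroup.mem_bot.1 (h1 hf))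
  have key2 : ∀ {u v w : G}, GeneratingTriple u v w → Commute u v → Commute u w → Commute v w →
      u ^ 2 = 1 → False := fun {u v w} h huv huw hvw hu => by
    rcases hsq v with hv | hv
    · exact key h huv hu hv
    · rcases hsq w with hw | hw
      · exact key h.rotate.rotate.swap huw hu hw
      · exact key h.rotate.mul.rotate.rotate (huv.mul_right huw) hu (hmul hvw hv hw)
  -- One of x, y, xy has square 1 and can be completed to a triple; `key2` then finds a second such
  -- member.
  rcases hsq x with hx | hx
  · exact key2 h hxy hxw hyw hx
  · rcases hsq y with hy | hy
    · exact key2 h.swap hxy.symm hyw hxw hy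
    · exact key2 h.mul (hxy.mul_left (Commute.refl y)) (hxw.mul_left hyw) hyw
        (hmul hxy hx hy)

/-- If the squares generate a subgroup of order two, then the group is generated by a quaternion
group and a central element. -/
theorem exists_of_card_squares_eq_two (hG : IsCritical G) (h2 : Nat.card (squares G) = 2) :
    ∃ f x y w : G, GeneratingTriple x y w ∧ f ∈ squares G ∧ (∀ g ∈ squares G, g = 1 ∨ g = f) ∧
      f ^ 2 = 1 ∧ Commute x w ∧ Commute y w ∧ x ^ 2 = f ∧ y ^ 2 = f ∧
      x * y = f * (y * x) ∧ (w ^ 2 = 1 ∨ w ^ 2 = f) := by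
  obtain ⟨f, hf, hfc, hf1, hf2⟩ := hG.exists_central_involution fun hb => by simp [hb] at h2
  have hF : ∀ g ∈ squares G, g = 1 ∨ g = f := fun g => eq_one_or_eq_of_card_two h2 hf hf1
  have hff : f * f = 1 := by rw [← pow_two, hf2]
  have hc : ∀ u v : G, CommutesUpTo 1 u v ∨ CommutesUpTo f u v := fun u v => by
    have h1 := commutesUpTo_commutator (fun g hg => by
      rcases hF g hg with rfl | rfl
      exacts [one_mem _, hfc]) u v
    rcases hF _ (commutator_mem_squares u v) with h3 | h3 <;> rw [h3] at h1
    exacts [Or.inl h1, Or.inr h1]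
  have hinv : f⁻¹ = f := inv_eq_of_mul_eq_one_left hff
  -- a generating triple whose last member is central
  have key : ∀ {x y w : G}, GeneratingTriple x y w → CommutesUpTo f x y →
      ∃ v, GeneratingTriple x y v ∧ Commute x v ∧ Commute y v := by
    intro x y w h hxy
    have hyx := hxy.symm
    rw [hinv] at hyx
    have hx := CommutesUpTo.self x
    have hy := CommutesUpTo.self y
    -- Multiplying w by x changes only its commutator with y, and multiplying by y only that with x,
    -- so both can be made trivial.
    rcases hc x w with h3 | h3 <;> rcases hc y w with h4 | h4
    · exact ⟨w, h, commutesUpTo_one.1 h3, commutesUpTo_one.1 h4⟩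
    · refine ⟨w * x, h.rotate.rotate.mul.rotate, ?_, ?_⟩ <;> rw [← commutesUpTo_one]
      · simpa using h3.mul_right hx
      · simpa [hff] using h4.mul_right hyx
    · refine ⟨w * y, h.rotate.rotate.mul_right.rotate, ?_, ?_⟩ <;> rw [← commutesUpTo_one]
      · simpa [hff] using h3.mul_right hxy
      · simpa using h4.mul_right hy
    · refine ⟨w * x * y, h.rotate.rotate.mul.mul_right.rotate, ?_, ?_⟩ <;> rw [← commutesUpTo_one]
      · simpa [hff] using (h3.mul_right hx).mul_right hxy
      · simpa [hff] using (h4.mul_right hyx).mul_right hy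
  have key2 : ∃ x y w : G, GeneratingTriple x y w ∧ CommutesUpTo f x y ∧ Commute x w ∧
      Commute y w := by
    obtain ⟨x, y, w, h⟩ := hG.exists_triple
    rcases hc x y with h3 | h3
    · rcases hc y w with h4 | h4
      · rcases hc w x with h5 | h5
        · exact (hG.not_commute_of_card_two h2 h (commutesUpTo_one.1 h3)
            (commutesUpTo_one.1 h5).symm (commutesUpTo_one.1 h4)).elim
        · obtain ⟨v, hv⟩ := key h.rotate.rotate h5
          exact ⟨w, x, v, hv.1, h5, hv.2⟩
      · obtain ⟨v, hv⟩ := key h.rotate h4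
        exact ⟨y, w, v, hv.1, h4, hv.2⟩
    · obtain ⟨v, hv⟩ := key h h3
      exact ⟨x, y, v, hv.1, h3, hv.2⟩
  have hsq : ∀ g : G, g ^ 2 = 1 ∨ g ^ 2 = f := fun g => hF _ (sq_mem_squares g)
  -- members of the triple may be made to square to `f`
  have key3 : ∀ {x y w : G}, GeneratingTriple x y w → CommutesUpTo f x y → Commute x w →
      Commute y w → ∃ x' : G, GeneratingTriple x' y w ∧ CommutesUpTo f x' y ∧ Commute x' w ∧
      x' ^ 2 = f := by
    intro x y w h hxy hxw hyw
    rcases hsq x with hx | hx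
    · refine ⟨x * w, h.mul_right, ?_, hxw.mul_left (Commute.refl w), ?_⟩
      · simpa using hxy.mul_left (commutesUpTo_one.2 hyw.symm)
      -- If w² = 1 as well, then x and w commute with squares 1, forcing `squares G` to be trivial.
      · rcases hsq w with hw | hw
        · have h1 := hG.squares_le_of_sq_mem h.rotate.rotate (N := ⊥) bot_le
            (Subgroup.mem_bot.2 hw) (Subgroup.mem_bot.2 hx)
            (Subgroup.mem_bot.2 (by simp [hxw.symm.eq]))
          exact absurd (Subgroup.mem_bot.1 (h1 hf)) hf1
        · rw [hxw.mul_pow, hx, hw, one_mul]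
    · exact ⟨x, h, hxy, hxw, hx⟩
  obtain ⟨x, y, w, h, hxy, hxw, hyw⟩ := key2
  obtain ⟨x, h, hxy, hxw, hx⟩ := key3 h hxy hxw hyw
  have hyx := hxy.symm
  rw [hinv] at hyx
  obtain ⟨y, h, hyx, hyw, hy⟩ := key3 h.swap hyx hyw hxw
  have hxy := hyx.symm
  rw [hinv] at hxy
  exact ⟨f, x, y, w, h.swap, hf, hF, hf2, hxw, hyw, hx, hy, hxy.2, hsq w⟩

/-- If the squares generate a subgroup of order four, it is central of exponent two. -/
theorem squares_le_center_of_card_four (hG : IsCritical G) (h4 : Nat.card (squares G) = 4) :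
    squares G ≤ Subgroup.center G ∧ ∀ g ∈ squares G, g ^ 2 = 1 := by
  obtain ⟨z, hz, hzc, hz1, hz2⟩ := hG.exists_central_involution fun hb => by simp [hb] at h4
  have hn := normal_zpowers_of_mem_center hzc
  have hle : Subgroup.zpowers z ≤ squares G := Subgroup.zpowers_le.2 hz
  have h2 := card_squares_quotient hz hz1 hz2
  obtain ⟨f, x, y, w, h, -, hF, -, hxw, hyw, hx, hy, hxy, -⟩ :=
    (hG.quotient hle).exists_of_card_squares_eq_two (by omega)
  obtain ⟨f, rfl⟩ := QuotientGroup.mk_surjective f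
  obtain ⟨x, rfl⟩ := QuotientGroup.mk_surjective x
  obtain ⟨y, rfl⟩ := QuotientGroup.mk_surjective y
  obtain ⟨w, rfl⟩ := QuotientGroup.mk_surjective w
  have h := hG.lift_triple hle h
  obtain ⟨s, hs, hs2, -, hx⟩ := exists_eq_mul_of_mk_eq (u := x ^ 2) hzc hz2 hx
  obtain ⟨t, ht, ht2, -, hy⟩ := exists_eq_mul_of_mk_eq (u := y ^ 2) hzc hz2 hy
  obtain ⟨r, hr, hr2, -, hxy⟩ := exists_eq_mul_of_mk_eq (u := x * y) (v := f * (y * x)) hzc hz2 hxy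
  obtain ⟨p, hp, hp2, -, hxw⟩ := exists_eq_mul_of_mk_eq (u := x * w) (v := w * x) hzc hz2 hxw
  have comm : ∀ {s : G}, s ∈ Subgroup.center G → ∀ g, Commute g s :=
    fun hs g => Subgroup.mem_center_iff.1 hs g
  -- Up to central factors f is both x² and y², so it commutes with x and y; x² commutes with w
  -- because [x, w] is central of square 1.
  have hfx : f = s⁻¹ * x ^ 2 := by rw [hx, inv_mul_cancel_left]
  have hfy : f = t⁻¹ * y ^ 2 := by rw [hy, inv_mul_cancel_left]
  have cx : Commute x f := by
    rw [hfx]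
    exact (comm (inv_mem hs) x).mul_right ((Commute.refl x).pow_right 2)
  have cy : Commute y f := by
    rw [hfy]
    exact (comm (inv_mem ht) y).mul_right ((Commute.refl y).pow_right 2)
  have cw : Commute w f := by
    rw [hfx]
    exact (comm (inv_mem hs) w).mul_right (CommutesUpTo.commute_sq ⟨hp, hxw⟩ hp2).symm
  have hfc : f ∈ Subgroup.center G := h.mem_center cx cy cw
  have hf2 : f ^ 2 = 1 := by
    -- As x² = sf is central, 1 = [x², y] = (rf)² = f².
    have h1 : CommutesUpTo (r * f) x y := ⟨mul_mem hr hfc, by rw [hxy, mul_assoc]⟩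
    have h3 := (h1.mul_left h1).2
    rw [← pow_two, ← pow_two, hx, ← (comm (mul_mem hs hfc) y).eq, eq_comm, mul_eq_right,
      (comm hfc r).mul_pow, hr2, one_mul] at h3
    exact h3
  have key : ∀ g ∈ squares G, g ∈ Subgroup.center G ∧ g ^ 2 = 1 := by
    intro g hg
    have hg' : (g : G ⧸ Subgroup.zpowers z) ∈ squares (G ⧸ Subgroup.zpowers z) := by
      rw [← map_squares (QuotientGroup.mk'_surjective (Subgroup.zpowers z))]
      exact ⟨g, hg, rfl⟩
    rcases hF _ hg' with h1 | h1
    · obtain ⟨q, hq, hq2, -, rfl⟩ := exists_eq_mul_of_mk_eq (v := 1) hzc hz2 h1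
      rw [mul_one]
      exact ⟨hq, hq2⟩
    · obtain ⟨q, hq, hq2, -, rfl⟩ := exists_eq_mul_of_mk_eq hzc hz2 h1
      exact ⟨mul_mem hq hfc, by rw [(comm hfc q).mul_pow, hq2, hf2, one_mul]⟩
  exact ⟨fun g hg => (key g hg).1, fun g hg => (key g hg).2⟩

/-- If the squares generate a subgroup of order four, all involutions lie in it. -/
theorem sq_ne_one_of_notMem (hG : IsCritical G) (h4 : Nat.card (squares G) = 4) {u : G}
    (hu : u ∉ squares G) : u ^ 2 ≠ 1 := by
  intro hu2
  obtain ⟨hc, h2⟩ := hG.squares_le_center_of_card_four h4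
  -- If u² = 1, this proper subgroup is elementary abelian, so it has order at most 4 and equals
  -- `squares G`.
  set H := Subgroup.closure {u} ⊔ squares G with hH
  have huH : u ∈ H := le_sup_left (b := squares G) (Subgroup.subset_closure rfl)
  have hle : squares G ≤ H := le_sup_right
  have htop : H ≠ ⊤ := by
    have h1 := hG.closure_pair_sup_ne_top u u
    rwa [Set.pair_eq_singleton] at h1
  have h1 := hG.card_le_four htop fun g hg => by
    obtain ⟨k, hk, f, hf, rfl⟩ := Subgroup.mem_sup_of_normal_right.1 hg
    rw [← Subgroup.zpowers_eq_closure] at hk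
    have hkf : Commute k f := Subgroup.mem_center_iff.1 (hc hf) k
    rw [hkf.mul_pow, h2 f hf, mul_one]
    rcases mem_zpowers_of_sq_eq_one hu2 hk with rfl | rfl
    exacts [one_pow 2, hu2]
  have h3 := Subgroup.eq_of_le_of_card_ge hle (by omega)
  exact hu (h3 ▸ huH)

end IsCritical

/-! ### Frattini subgroup of order four, and exclusion of order eight -/

namespace IsCritical

variable {G : Type*} [Group G] [Finite G]

theorem exists_commutesUpTo (hG : IsCritical G) (h4 : Nat.card (squares G) = 4) (u v : G) :
    ∃ s ∈ squares G, CommutesUpTo s u v ∧ CommutesUpTo s v u := by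
  obtain ⟨hc, h2⟩ := hG.squares_le_center_of_card_four h4
  have h1 := commutesUpTo_commutator hc u v
  have h3 := commutator_mem_squares u v
  refine ⟨_, h3, h1, ?_⟩
  have h5 := h1.symm
  rwa [inv_eq_of_mul_eq_one_left (by rw [← pow_two, h2 _ h3])] at h5

theorem dependent_squares (hG : IsCritical G) (h4 : Nat.card (squares G) = 4) {p q r : G}
    (hp : p ∈ squares G) (hq : q ∈ squares G) (hr : r ∈ squares G) :
    p = 1 ∨ q = 1 ∨ r = 1 ∨ p * q = 1 ∨ r = p ∨ r = q ∨ r = p * q := by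
  have h := dependent_of_card_le_four (Q := squares G)
    (fun g => Subtype.ext ((hG.squares_le_center_of_card_four h4).2 g g.2)) h4.le
    ⟨p, hp⟩ ⟨q, hq⟩ ⟨r, hr⟩
  simpa only [Subtype.ext_iff, Subgroup.coe_one, Subgroup.coe_mul] using h

/-- The three basic commutators lie in a plane over 𝔽₂, so they satisfy a nontrivial linear
relation. Every vector in the exterior square of a 3-dimensional space is decomposable, so each of
the seven relations says that some independent pair commutes. -/
theorem exists_commuting_triple (hG : IsCritical G) (h4 : Nat.card (squares G) = 4) :
    ∃ a b c : G, GeneratingTriple a b c ∧ Commute a b := by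
  obtain ⟨hc, h2⟩ := hG.squares_le_center_of_card_four h4
  obtain ⟨x, y, w, h⟩ := hG.exists_triple
  obtain ⟨p, hp, hxy, hyx⟩ := hG.exists_commutesUpTo h4 x y
  obtain ⟨q, hq, hxw, hwx⟩ := hG.exists_commutesUpTo h4 x w
  obtain ⟨r, hr, hyw, hwy⟩ := hG.exists_commutesUpTo h4 y w
  have hpp : p * p = 1 := by rw [← pow_two, h2 p hp]
  have hqq : q * q = 1 := by rw [← pow_two, h2 q hq]
  rcases hG.dependent_squares h4 hp hq hr with h1 | h1 | h1 | h1 | h1 | h1 | h1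
  · rw [h1] at hxy
    exact ⟨x, y, w, h, commutesUpTo_one.1 hxy⟩
  · rw [h1] at hwx
    exact ⟨w, x, y, h.rotate.rotate, commutesUpTo_one.1 hwx⟩
  · rw [h1] at hyw
    exact ⟨y, w, x, h.rotate, commutesUpTo_one.1 hyw⟩
  · have h3 := hxy.mul_right hxw
    rw [h1] at h3
    exact ⟨x, y * w, w, h.rotate.mul.rotate.rotate, commutesUpTo_one.1 h3⟩
  · have h3 := hyx.mul_right hyw
    rw [h1, hpp] at h3
    exact ⟨y, x * w, w, h.mul_right.swap, commutesUpTo_one.1 h3⟩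
  · have h3 := hwx.mul_right hwy
    rw [h1, hqq] at h3
    exact ⟨w, x * y, y, h.mul.rotate.rotate, commutesUpTo_one.1 h3⟩
  · have h3 := (hxy.mul_right hxw).mul_left (hwy.mul_right (CommutesUpTo.self w))
    rw [mul_one, h1, ← pow_two, h2 _ (mul_mem hp hq)] at h3
    exact ⟨x * w, y * w, w, h.mul_right.swap.mul_right.swap, commutesUpTo_one.1 h3⟩

/-- None of a, b, ab lies in `squares G`, so a², b² and a²b² = (ab)² are nontrivial; hence a² and b²
form a basis. -/
theorem eq_of_mem_squares (hG : IsCritical G) (h4 : Nat.card (squares G) = 4) {a b c : G}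
    (h : GeneratingTriple a b c) (hab : Commute a b) {g : G} (hg : g ∈ squares G) :
    g = 1 ∨ g = a ^ 2 ∨ g = b ^ 2 ∨ g = a ^ 2 * b ^ 2 := by
  have h1 := hG.sq_ne_one_of_notMem h4 (hG.notMem_squares h.mul)
  rw [hab.mul_pow] at h1
  have h2 := hG.dependent_squares h4 (sq_mem_squares a) (sq_mem_squares b) hg
  have h3 := hG.sq_ne_one_of_notMem h4 (hG.notMem_squares h)
  have h5 := hG.sq_ne_one_of_notMem h4 (hG.notMem_squares h.swap)
  tauto

/-- Modulo ⟨s⟩ the elements a and b commute and have square 1, so `squares G` would lie in ⟨s⟩, of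
order at most 2. -/
theorem not_squares_eq (hG : IsCritical G) (h4 : Nat.card (squares G) = 4) {a b c s : G}
    (h : GeneratingTriple a b c) (hs : s ∈ squares G) (ha : a ^ 2 = s) (hb : b ^ 2 = s)
    (hab : CommutesUpTo s a b) : False := by
  obtain ⟨hc, h2⟩ := hG.squares_le_center_of_card_four h4
  have hn := normal_zpowers_of_mem_center (hc hs)
  have hm := Subgroup.mem_zpowers s
  have h1 := hG.squares_le_of_sq_mem h (Subgroup.zpowers_le.2 hs) (ha ▸ hm) (hb ▸ hm)
    (hab.commutator_mem hm)
  have h3 := Nat.le_of_dvd (Nat.pos_of_ne_zero (by simpa using (Nat.card_pos.ne' : Nat.card (Subgroup.zpowers s) ≠ 0)))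
    (Subgroup.card_dvd_of_le h1)
  rw [h4, Nat.card_zpowers] at h3
  have h5 := orderOf_le_of_pow_eq_one (by norm_num) (h2 s hs)
  omega

/-- The relations which hold between suitable generators if the squares generate a subgroup of
order four. -/
theorem exists_of_card_squares_eq_four (hG : IsCritical G) (h4 : Nat.card (squares G) = 4) :
    ∃ a b c : G, GeneratingTriple a b c ∧ Commute a b ∧ c ^ 2 = a ^ 2 ∧ (a ^ 2) ^ 2 = 1 ∧
      (b ^ 2) ^ 2 = 1 ∧ CommutesUpTo (b ^ 2) a c ∧ CommutesUpTo (a ^ 2) b c ∧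
      ∀ g ∈ squares G, g = 1 ∨ g = a ^ 2 ∨ g = b ^ 2 ∨ g = a ^ 2 * b ^ 2 := by
  obtain ⟨hc, h2⟩ := hG.squares_le_center_of_card_four h4
  have hne : ∀ {u v w : G}, GeneratingTriple u v w → u ^ 2 ≠ 1 := fun h =>
    hG.sq_ne_one_of_notMem h4 (hG.notMem_squares h)
  have hsq : ∀ g : G, g ^ 2 * g ^ 2 = 1 := fun g => by
    rw [← pow_two, h2 _ (sq_mem_squares g)]
  have hcomm : ∀ g k : G, g ^ 2 * k ^ 2 = k ^ 2 * g ^ 2 := fun g k =>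
    Subgroup.mem_center_iff.1 (hc (sq_mem_squares k)) _
  have key : ∃ a b c : G, GeneratingTriple a b c ∧ Commute a b ∧ c ^ 2 = a ^ 2 := by
    obtain ⟨a, b, c, h, hab⟩ := hG.exists_commuting_triple h4
    rcases hG.eq_of_mem_squares h4 h hab (sq_mem_squares c) with h1 | h1 | h1 | h1
    · exact absurd h1 (hne h.rotate.rotate)
    · exact ⟨a, b, c, h, hab, h1⟩
    · exact ⟨b, a, c, h.swap, hab.symm, h1⟩
    · exact ⟨a * b, b, c, h.mul, hab.mul_left (Commute.refl b), by rw [h1, hab.mul_pow]⟩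
  have key2 : ∃ a b c : G, GeneratingTriple a b c ∧ Commute a b ∧ c ^ 2 = a ^ 2 ∧
      CommutesUpTo (b ^ 2) a c := by
    obtain ⟨a, b, c, h, hab, hca⟩ := key
    obtain ⟨s, hs, hac, hac'⟩ := hG.exists_commutesUpTo h4 a c
    -- The value 1 for [a, c] gives (ac)² = 1; the value a² is excluded by `not_squares_eq`; a²b² =
    -- (ba)² is repaired by replacing b with ba.
    rcases hG.eq_of_mem_squares h4 h hab hs with h1 | h1 | h1 | h1
    · refine absurd ?_ (hne h.mul_right)
      rw [hac'.mul_sq, h1, hca, hsq, one_mul]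
    · rw [h1] at hac
      exact (hG.not_squares_eq h4 h.rotate.rotate.swap (sq_mem_squares a) rfl hca hac).elim
    · exact ⟨a, b, c, h, hab, hca, h1 ▸ hac⟩
    · refine ⟨a, b * a, c, h.swap.mul.swap, hab.mul_right (Commute.refl a), hca, ?_⟩
      rwa [hab.symm.mul_pow, hcomm, ← h1]
  obtain ⟨a, b, c, h, hab, hca, hac⟩ := key2
  refine ⟨a, b, c, h, hab, hca, h2 _ (sq_mem_squares a), h2 _ (sq_mem_squares b), hac, ?_,
    fun g => hG.eq_of_mem_squares h4 h hab⟩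
  have hinv : ∀ g : G, (g ^ 2)⁻¹ = g ^ 2 := fun g => inv_eq_of_mul_eq_one_left (hsq g)
  have hac' := hac.symm
  rw [hinv] at hac'
  obtain ⟨s, hs, hbc, hbc'⟩ := hG.exists_commutesUpTo h4 b c
  rcases hG.eq_of_mem_squares h4 h hab hs with h1 | h1 | h1 | h1 <;> rw [h1] at hbc hbc'
  · -- `(a * b * c) ^ 2 = 1`
    refine absurd ?_ (hne h.mul.mul_right)
    rw [(hac'.mul_right hbc').mul_sq, hab.mul_pow, hca, hcomm a b, mul_one, mul_assoc (b ^ 2),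
      hsq, mul_one, hsq]
  · exact hbc
  · -- `b` and `a * c` both square to `b ^ 2`
    refine (hG.not_squares_eq h4 h.mul_right.swap (sq_mem_squares b) rfl ?_ ?_).elim
    · rw [hac'.mul_sq, hca, hsq, mul_one]
    · simpa using (commutesUpTo_one.2 hab.symm).mul_right hbc
  · refine absurd ?_ (hne h.rotate.mul)
    rw [hbc'.mul_sq, hca, hcomm a b, ← pow_two,
      h2 _ (mul_mem (sq_mem_squares b) (sq_mem_squares a))]

/-- The relations for order four hold modulo a central involution z. Lifted to G they still force a⁴
= b⁴ = 1, so `squares G` would be a proper elementary abelian subgroup of order 8. -/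
theorem card_squares_ne_eight (hG : IsCritical G) : Nat.card (squares G) ≠ 8 := by
  intro h8
  obtain ⟨z, hz, hzc, hz1, hz2⟩ := hG.exists_central_involution fun hb => by simp [hb] at h8
  have hn := normal_zpowers_of_mem_center hzc
  have hle : Subgroup.zpowers z ≤ squares G := Subgroup.zpowers_le.2 hz
  have h2 := card_squares_quotient hz hz1 hz2
  obtain ⟨a, b, c, h, hab, hca, ha4, hb4, hac, hbc, hF⟩ :=
    (hG.quotient hle).exists_of_card_squares_eq_four (by omega)
  obtain ⟨a, rfl⟩ := QuotientGroup.mk_surjective a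
  obtain ⟨b, rfl⟩ := QuotientGroup.mk_surjective b
  obtain ⟨c, rfl⟩ := QuotientGroup.mk_surjective c
  have h := hG.lift_triple hle h
  have comm : ∀ {s : G}, s ∈ Subgroup.center G → ∀ g, Commute g s :=
    fun hs g => Subgroup.mem_center_iff.1 hs g
  obtain ⟨s, hs, hs2, -, hab⟩ := exists_eq_mul_of_mk_eq (u := a * b) (v := b * a) hzc hz2 hab
  obtain ⟨t, ht, -, -, hca⟩ := exists_eq_mul_of_mk_eq (u := c ^ 2) (v := a ^ 2) hzc hz2 hca
  obtain ⟨p, hp, hp2, -, hac⟩ :=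
    exists_eq_mul_of_mk_eq (u := a * c) (v := b ^ 2 * (c * a)) hzc hz2 hac.2
  obtain ⟨q, hq, hq2, -, hbc⟩ :=
    exists_eq_mul_of_mk_eq (u := b * c) (v := a ^ 2 * (c * b)) hzc hz2 hbc.2
  obtain ⟨r, hr, -, -, ha4⟩ := exists_eq_mul_of_mk_eq (u := (a ^ 2) ^ 2) (v := 1) hzc hz2 ha4
  rw [mul_one] at ha4
  have cab : Commute (a ^ 2) b := CommutesUpTo.commute_sq ⟨hs, hab⟩ hs2
  have cba : Commute (b ^ 2) a :=
    (CommutesUpTo.symm ⟨hs, hab⟩).commute_sq (by rw [inv_pow, hs2, inv_one])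
  have cac : Commute (a ^ 2) c := by
    have h1 : a ^ 2 = t⁻¹ * c ^ 2 := by rw [hca, inv_mul_cancel_left]
    rw [h1]
    exact ((comm (inv_mem ht) c).symm).mul_left ((Commute.refl c).pow_left 2)
  -- This says [u², v] = [u, v]² when [u, v] commutes with u. Since a² commutes with c, it gives
  -- (pb²)² = 1, hence b⁴ = 1; later the pair b, c gives a⁴ = 1.
  have hsq : ∀ {u v g : G}, Commute g u → u * v = g * (v * u) →
      u ^ 2 * v = g ^ 2 * (v * u ^ 2) := by
    intro u v g hg huv
    calc u ^ 2 * v = u * g * v * u := by rw [pow_two, mul_assoc, huv]; simp only [mul_assoc]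
      _ = g * (u * v) * u := by rw [← hg.eq, mul_assoc g]
      _ = g ^ 2 * (v * u ^ 2) := by rw [huv]; simp only [pow_two, mul_assoc]
  have hb4 : (b ^ 2) ^ 2 = 1 := by
    have h1 := hsq (((comm hp a).symm).mul_left cba) (hac.trans (mul_assoc _ _ _).symm)
    rw [cac.eq, right_eq_mul, (comm hp _).symm.mul_pow, hp2, one_mul] at h1
    exact h1
  -- Up to a central factor b² is (ac)², so it commutes with ac; as it commutes with a, it commutes
  -- with c.
  have cbac : Commute (b ^ 2) (a * c) := by
    have h1 : (a * c) ^ 2 = p * t * r * b ^ 2 := by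
      calc (a * c) ^ 2 = a * c * (a * c) := pow_two _
        _ = p * (b ^ 2 * (c * a)) * (a * c) := by rw [← hac]
        _ = p * (b ^ 2 * (c * a ^ 2 * c)) := by simp only [pow_two, mul_assoc]
        _ = p * (b ^ 2 * (t * (a ^ 2) ^ 2)) := by
          rw [← cac.eq, mul_assoc (a ^ 2), ← pow_two c, hca, ← mul_assoc (a ^ 2), comm ht (a ^ 2),
            mul_assoc t, ← pow_two (a ^ 2)]
        _ = p * t * r * b ^ 2 := by
          rw [ha4, comm (mul_mem ht hr) (b ^ 2)]; simp only [mul_assoc]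
    have h3 : b ^ 2 = (p * t * r)⁻¹ * (a * c) ^ 2 := by rw [h1, inv_mul_cancel_left]
    rw [h3]
    exact ((comm (inv_mem (mul_mem (mul_mem hp ht) hr)) _).symm).mul_left
      ((Commute.refl _).pow_left 2)
  have cbc : Commute (b ^ 2) c := by
    have h1 := cba.inv_right.mul_right cbac
    rwa [inv_mul_cancel_left] at h1
  have ha4 : (a ^ 2) ^ 2 = 1 := by
    have h1 := hsq (((comm hq b).symm).mul_left cab) (hbc.trans (mul_assoc _ _ _).symm)
    rw [cbc.eq, right_eq_mul, (comm hq _).symm.mul_pow, hq2, one_mul] at h1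
    exact h1
  have h1 := hG.card_le_four hG.squares_ne_top fun g hg => by
    have hg' : (g : G ⧸ Subgroup.zpowers z) ∈ squares (G ⧸ Subgroup.zpowers z) := by
      rw [← map_squares (QuotientGroup.mk'_surjective (Subgroup.zpowers z))]
      exact ⟨g, hg, rfl⟩
    have key : ∀ v : G, (g : G ⧸ Subgroup.zpowers z) = v → v ^ 2 = 1 → g ^ 2 = 1 := by
      intro v hv hv2
      obtain ⟨k, hk, hk2, -, rfl⟩ := exists_eq_mul_of_mk_eq hzc hz2 hv
      rw [(comm hk v).symm.mul_pow, hk2, hv2, one_mul]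
    rcases hF _ hg' with h1 | h1 | h1 | h1
    · exact key 1 h1 (one_pow 2)
    · exact key (a ^ 2) h1 ha4
    · exact key (b ^ 2) h1 hb4
    · exact key (a ^ 2 * b ^ 2) h1 (by rw [(cab.pow_right 2).mul_pow, ha4, hb4, one_mul])
  omega

end IsCritical

/-- Factoring out a central involution halves the order, so by induction the only further candidate
is 8, already excluded. -/
theorem IsCritical.card_squares_cases {G : Type*} [Group G] [Finite G] (hG : IsCritical G) :
    Nat.card (squares G) = 1 ∨ Nat.card (squares G) = 2 ∨ Nat.card (squares G) = 4 := by
  induction hk : Nat.card (squares G) using Nat.strong_induction_on generalizing G with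
  | _ k ih =>
    by_cases hb : squares G = ⊥
    · rw [hb, Subgroup.card_bot] at hk
      exact Or.inl hk.symm
    · obtain ⟨z, hz, hzc, hz1, hz2⟩ := hG.exists_central_involution hb
      have hn := normal_zpowers_of_mem_center hzc
      have h2 := card_squares_quotient hz hz1 hz2
      have hp : 0 < Nat.card (squares G) := Nat.card_pos
      have h3 := hG.card_squares_ne_eight
      have h4 := ih _ (by omega) (hG.quotient (Subgroup.zpowers_le.2 hz)) rfl
      omega

/-! ### Homomorphisms out of cyclic and quaternion groups -/

section Lifts

variable {G : Type*} [Group G]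

/-- The homomorphism from a cyclic group sending the standard generator to a given element. -/
def cycLift (n : ℕ) (x : G) (hx : x ^ n = 1) : Cyc n →* G :=
  AddMonoidHom.toMultiplicativeLeft
    (ZMod.lift n ⟨zmultiplesHom (Additive G) (Additive.ofMul x), by
      rw [zmultiplesHom_apply, natCast_zsmul, ← ofMul_pow, hx, ofMul_one]⟩)

theorem cycLift_apply {n : ℕ} {x : G} (hx : x ^ n = 1) (k : ℤ) :
    cycLift n x hx (Multiplicative.ofAdd (k : ZMod n)) = x ^ k := by
  simp [cycLift]

theorem cycLift_one {n : ℕ} {x : G} (hx : x ^ n = 1) :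
    cycLift n x hx (Multiplicative.ofAdd 1) = x := by
  simpa using cycLift_apply hx 1

theorem cycLift_two {n : ℕ} {x : G} (hx : x ^ n = 1) :
    cycLift n x hx (Multiplicative.ofAdd 2) = x ^ 2 := by
  simpa using cycLift_apply hx 2

theorem exists_eq_ofAdd_intCast {n : ℕ} (g : Cyc n) :
    ∃ k : ℤ, g = Multiplicative.ofAdd (k : ZMod n) :=
  (ZMod.intCast_surjective (Multiplicative.toAdd g)).imp fun _ h => by rw [h, ofAdd_toAdd]

theorem commute_cycLift {n : ℕ} {x : G} (hx : x ^ n = 1) {g : G} (h : Commute x g) (k : Cyc n) :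
    Commute (cycLift n x hx k) g := by
  obtain ⟨k, rfl⟩ := exists_eq_ofAdd_intCast k
  rw [cycLift_apply]
  exact h.zpow_left k

/-- The homomorphism from the quaternion group of order eight sending the standard generators to
given elements. -/
def quaternionLift (x y : G) (hx : x ^ 4 = 1) (hy : y ^ 2 = x ^ 2) (hxy : x * y = y * x⁻¹) :
    QuaternionGroup 2 →* G where
  toFun
    | .a i => cycLift 4 x hx (Multiplicative.ofAdd i)
    | .xa i => y * cycLift 4 x hx (Multiplicative.ofAdd i)
  map_one' := (cycLift 4 x hx).map_one
  map_mul' := by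
    have key : ∀ i : ZMod 4, cycLift 4 x hx (Multiplicative.ofAdd i) * y =
        y * cycLift 4 x hx (Multiplicative.ofAdd (-i)) := by
      intro i
      obtain ⟨k, rfl⟩ := ZMod.intCast_surjective i
      rw [← Int.cast_neg, cycLift_apply, cycLift_apply, zpow_neg, ← inv_zpow]
      exact (SemiconjBy.zpow_right (a := y) (x := x⁻¹) (y := x) hxy.symm k).eq.symm
    have key2 : y * y = cycLift 4 x hx (Multiplicative.ofAdd 2) := by
      rw [cycLift_two, ← hy, pow_two]
    rintro (i | i) (j | j)
    · simp only [QuaternionGroup.a_mul_a]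
      exact (cycLift 4 x hx).map_mul (Multiplicative.ofAdd i) (Multiplicative.ofAdd j)
    · simp only [QuaternionGroup.a_mul_xa]
      rw [← mul_assoc, key, mul_assoc, ← map_mul, ← ofAdd_add, neg_add_eq_sub]
    · simp only [QuaternionGroup.xa_mul_a]
      rw [mul_assoc, ← map_mul, ← ofAdd_add]
    · simp only [QuaternionGroup.xa_mul_xa]
      rw [mul_assoc, ← mul_assoc _ y, key, mul_assoc, ← mul_assoc, key2, ← map_mul, ← map_mul,
        ← ofAdd_add, ← ofAdd_add, neg_add_eq_sub, add_sub_assoc]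
      rfl

theorem quaternionLift_a_one {x y : G} (hx : x ^ 4 = 1) (hy : y ^ 2 = x ^ 2)
    (hxy : x * y = y * x⁻¹) : quaternionLift x y hx hy hxy (.a 1) = x :=
  cycLift_one hx

theorem quaternionLift_a_two {x y : G} (hx : x ^ 4 = 1) (hy : y ^ 2 = x ^ 2)
    (hxy : x * y = y * x⁻¹) : quaternionLift x y hx hy hxy (.a 2) = x ^ 2 :=
  cycLift_two hx

theorem quaternionLift_xa_zero {x y : G} (hx : x ^ 4 = 1) (hy : y ^ 2 = x ^ 2)
    (hxy : x * y = y * x⁻¹) : quaternionLift x y hx hy hxy (.xa 0) = y := by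
  change y * cycLift 4 x hx (Multiplicative.ofAdd 0) = y
  rw [ofAdd_zero, map_one, mul_one]

theorem commute_quaternionLift {x y : G} (hx : x ^ 4 = 1) (hy : y ^ 2 = x ^ 2)
    (hxy : x * y = y * x⁻¹) {g : G} (hgx : Commute g x) (hgy : Commute g y)
    (q : QuaternionGroup 2) : Commute g (quaternionLift x y hx hy hxy q) := by
  rcases q with i | i
  · exact (commute_cycLift hx hgx.symm _).symm
  · exact hgy.mul_right (commute_cycLift hx hgx.symm _).symm

/-- A surjection from a finite group onto one at least as large is bijective; only a lower bound on
|G| is needed. -/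
theorem nonempty_mulEquiv_of_card_le {H : Type*} [Group H] [Finite H] (φ : H →* G)
    {x y w : G} (h : GeneratingTriple x y w) (hx : x ∈ φ.range) (hy : y ∈ φ.range)
    (hw : w ∈ φ.range) (hc : Nat.card H ≤ Nat.card G) : Nonempty (G ≃* H) :=
  ⟨(MulEquiv.ofBijective φ (Function.Surjective.bijective_of_nat_card_le
    (MonoidHom.range_eq_top.1 (h.le hx hy hw)) hc)).symm⟩

theorem mul_eq_mul_inv_of_quaternion {x y f : G} (hx : x ^ 2 = f) (hf : f ^ 2 = 1)
    (hy : y ^ 2 = f) (hxy : x * y = f * (y * x)) : x * y = y * x⁻¹ := by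
  have h1 : Commute f y := hy ▸ (Commute.refl y).pow_left 2
  have h2 : f * x = x⁻¹ := by
    rw [eq_inv_iff_mul_eq_one, mul_assoc, ← pow_two, hx, ← pow_two, hf]
  rw [hxy, ← mul_assoc, h1.eq, mul_assoc, h2]

end Lifts

/-! ### Recognising the groups (a), (b), (c) -/

section Recognition

variable {G : Type*} [Group G]

theorem nonempty_mulEquiv_elementary {x y w : G} (h : GeneratingTriple x y w) (hx : x ^ 2 = 1)
    (hy : y ^ 2 = 1) (hw : w ^ 2 = 1) (hxy : Commute x y) (hxw : Commute x w) (hyw : Commute y w)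
    (hc : 8 ≤ Nat.card G) : Nonempty (G ≃* Cyc 2 × Cyc 2 × Cyc 2) := by
  have h1 : ∀ m n, Commute (cycLift 2 y hy m) (cycLift 2 w hw n) := fun m n =>
    commute_cycLift hy (commute_cycLift hw hyw.symm n).symm m
  have h2 : ∀ m n, Commute (cycLift 2 x hx m)
      ((cycLift 2 y hy).noncommCoprod (cycLift 2 w hw) h1 n) := fun m n =>
    (commute_cycLift hx (commute_cycLift hy hxy.symm n.1).symm m).mul_right
      (commute_cycLift hx (commute_cycLift hw hxw.symm n.2).symm m)
  refine nonempty_mulEquiv_of_card_le ((cycLift 2 x hx).noncommCoprod _ h2) h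
    ⟨(Multiplicative.ofAdd 1, 1, 1), ?_⟩ ⟨(1, Multiplicative.ofAdd 1, 1), ?_⟩
    ⟨(1, 1, Multiplicative.ofAdd 1), ?_⟩ ?_
  · simp [cycLift_one]
  · simp [cycLift_one]
  · simp [cycLift_one]
  · simpa [Nat.card_eq_fintype_card] using hc

theorem nonempty_mulEquiv_cyc_prod_quaternion {x y w f : G} (h : GeneratingTriple x y w)
    (hf : f ^ 2 = 1) (hx : x ^ 2 = f) (hy : y ^ 2 = f) (hxy : x * y = f * (y * x))
    (hw : w ^ 2 = 1) (hxw : Commute x w) (hyw : Commute y w) (hc : 16 ≤ Nat.card G) :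
    Nonempty (G ≃* Cyc 2 × QuaternionGroup 2) := by
  have hx4 : x ^ 4 = 1 := by rw [show 4 = 2 * 2 from rfl, pow_mul, hx, hf]
  have hy' : y ^ 2 = x ^ 2 := hy.trans hx.symm
  have hxy' := mul_eq_mul_inv_of_quaternion hx hf hy hxy
  refine nonempty_mulEquiv_of_card_le ((cycLift 2 w hw).noncommCoprod
    (quaternionLift x y hx4 hy' hxy') fun m n => commute_cycLift hw
      (commute_quaternionLift hx4 hy' hxy' hxw.symm hyw.symm n) m) h
    ⟨(1, .a 1), ?_⟩ ⟨(1, .xa 0), ?_⟩ ⟨(Multiplicative.ofAdd 1, 1), ?_⟩ ?_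
  · simp [quaternionLift_a_one]
  · simp [quaternionLift_xa_zero]
  · simp [cycLift_one]
  · simpa [Nat.card_eq_fintype_card, QuaternionGroup.card] using hc

theorem card_C4Q8 : Nat.card C4Q8 = 2 ^ 4 := by
  have h1 := Subgroup.card_eq_card_quotient_mul_card_subgroup amalgamC4Q8.kernel
  have h2 : Nat.card amalgamC4Q8.kernel = 2 := by
    rw [CentralAmalgam.kernel, Nat.card_zpowers]
    exact orderOf_eq_prime (by decide) (by decide)
  have h3 : Nat.card (Cyc 4 × QuaternionGroup 2) = 32 := by
    simp [Nat.card_eq_fintype_card, QuaternionGroup.card]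
  rw [h2, h3] at h1
  change 32 = Nat.card C4Q8 * 2 at h1
  omega

theorem card_C4D8 : Nat.card C4D8 = 2 ^ 4 := by
  have h1 := Subgroup.card_eq_card_quotient_mul_card_subgroup amalgamC4D8.kernel
  have h2 : Nat.card amalgamC4D8.kernel = 2 := by
    rw [CentralAmalgam.kernel, Nat.card_zpowers]
    exact orderOf_eq_prime (by decide) (by decide)
  have h3 : Nat.card (Cyc 4 × DihedralGroup 4) = 32 := by
    simp [Nat.card_eq_fintype_card, DihedralGroup.card]
  rw [h2, h3] at h1
  change 32 = Nat.card C4D8 * 2 at h1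
  omega

theorem nonempty_mulEquiv_C4Q8 {x y w f : G} (h : GeneratingTriple x y w)
    (hf : f ^ 2 = 1) (hx : x ^ 2 = f) (hy : y ^ 2 = f) (hxy : x * y = f * (y * x))
    (hw : w ^ 2 = f) (hxw : Commute x w) (hyw : Commute y w) (hc : 16 ≤ Nat.card G) :
    Nonempty (G ≃* C4Q8) := by
  have hx4 : x ^ 4 = 1 := by rw [show 4 = 2 * 2 from rfl, pow_mul, hx, hf]
  have hw4 : w ^ 4 = 1 := by rw [show 4 = 2 * 2 from rfl, pow_mul, hw, hf]
  have hy' : y ^ 2 = x ^ 2 := hy.trans hx.symm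
  have hxy' := mul_eq_mul_inv_of_quaternion hx hf hy hxy
  set φ := (cycLift 4 w hw4).noncommCoprod
    (quaternionLift x y hx4 hy' hxy') fun m n => commute_cycLift hw4
      (commute_quaternionLift hx4 hy' hxy' hxw.symm hyw.symm n) m with hφ
  have hker : amalgamC4Q8.kernel ≤ φ.ker := by
    rw [CentralAmalgam.kernel, Subgroup.zpowers_le, MonoidHom.mem_ker]
    change cycLift 4 w hw4 (Multiplicative.ofAdd 2) *
      quaternionLift x y hx4 hy' hxy' (QuaternionGroup.a 2)⁻¹ = 1
    rw [map_inv, quaternionLift_a_two, cycLift_two, hw, hx, mul_inv_cancel]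
  refine nonempty_mulEquiv_of_card_le (QuotientGroup.lift amalgamC4Q8.kernel φ hker) h
    ⟨((1, .a 1) : Cyc 4 × QuaternionGroup 2), ?_⟩ ⟨((1, .xa 0) : Cyc 4 × QuaternionGroup 2), ?_⟩
    ⟨((Multiplicative.ofAdd 1, 1) : Cyc 4 × QuaternionGroup 2), ?_⟩ ?_
  · rw [QuotientGroup.lift_mk]
    simp [hφ, quaternionLift_a_one]
  · rw [QuotientGroup.lift_mk]
    simp [hφ, quaternionLift_xa_zero]
  · rw [QuotientGroup.lift_mk]
    simp [hφ, cycLift_one]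
  · exact card_C4Q8.trans_le hc

/-- A reflection times a generator of C₄ squares to the amalgamated involution, so together with the
rotation r it forms a quaternion pair inside C₄ ∗ D₈. -/
theorem nonempty_C4Q8_mulEquiv_C4D8 : Nonempty (C4Q8 ≃* C4D8) := by
  have key : ∀ u v : Cyc 4 × DihedralGroup 4, u = v ∨
      u⁻¹ * v = (Multiplicative.ofAdd 2, (DihedralGroup.r 2)⁻¹) → (u : C4D8) = v := by
    rintro u v (rfl | h)
    · rfl
    · exact QuotientGroup.eq.2 (h ▸ Subgroup.mem_zpowers _)
  let x : Cyc 4 × DihedralGroup 4 := (1, .r 1)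
  let y : Cyc 4 × DihedralGroup 4 := (Multiplicative.ofAdd 1, .sr 0)
  let w : Cyc 4 × DihedralGroup 4 := (Multiplicative.ofAdd 1, 1)
  have h : GeneratingTriple (x : C4D8) y w := by
    have h1 : GeneratingTriple x y w := by
      rw [GeneratingTriple, eq_top_iff]
      have h2 : ∀ g : Cyc 4 × DihedralGroup 4, ∃ i j k : Fin 4,
          g = x ^ (i : ℕ) * y ^ (j : ℕ) * w ^ (k : ℕ) := by decide
      intro g _
      obtain ⟨i, j, k, rfl⟩ := h2 g
      have ⟨hx, hy, hw⟩ := mem_closure_triple x y w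
      exact mul_mem (mul_mem (pow_mem hx _) (pow_mem hy _)) (pow_mem hw _)
    exact h1.mk _
  obtain ⟨e⟩ := nonempty_mulEquiv_C4Q8 (f := ((x ^ 2 : Cyc 4 × DihedralGroup 4) : C4D8)) h
    (key (_ ^ 2) 1 (by decide)) rfl (key (y ^ 2) _ (by decide))
    (key (x * y) (x ^ 2 * (y * x)) (by decide)) (key (w ^ 2) _ (by decide))
    (key (x * w) (w * x) (by decide)) (key (y * w) (w * y) (by decide)) card_C4D8.ge
  exact ⟨e.symm⟩

end Recognition

/-! ### The presented group of order 32 -/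

section Presentation

theorem commute_of_rel {H : Type*} [Group H] {u v : H} (h : u * v * u⁻¹ * v⁻¹ = 1) :
    Commute u v := by
  rw [mul_inv_eq_one, mul_inv_eq_iff_eq_mul] at h
  exact h

/-- The relations of the presentation, for elements of an arbitrary group. -/
structure BlackburnRelations {H : Type*} [Group H] (a b c : H) : Prop where
  a_pow : a ^ 4 = 1
  b_pow : b ^ 4 = 1
  comm : a * b * a⁻¹ * b⁻¹ = 1
  c_sq : c ^ 2 * (a ^ 2)⁻¹ = 1
  conj_a : c⁻¹ * a * c * (a * b ^ 2)⁻¹ = 1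
  conj_b : c⁻¹ * b * c * (b * a ^ 2)⁻¹ = 1

/-- The homomorphism defined on the presented group by elements satisfying the relations. -/
def BlackburnRelations.lift {H : Type*} [Group H] {a b c : H} (h : BlackburnRelations a b c) :
    BlackburnGroup →* H :=
  PresentedGroup.toGroup (rels := blackburnRels) (f := ![a, b, c]) (by
    rintro r (rfl | rfl | rfl | rfl | rfl | rfl)
    · simpa using h.a_pow
    · simpa using h.b_pow
    · simpa using h.comm
    · simpa using h.c_sq
    · simpa using h.conj_a
    · simpa using h.conj_b)

theorem BlackburnRelations.mem_range_lift {H : Type*} [Group H] {a b c : H}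
    (h : BlackburnRelations a b c) : a ∈ h.lift.range ∧ b ∈ h.lift.range ∧ c ∈ h.lift.range :=
  ⟨⟨PresentedGroup.of 0, PresentedGroup.toGroup.of _⟩,
    ⟨PresentedGroup.of 1, PresentedGroup.toGroup.of _⟩,
    ⟨PresentedGroup.of 2, PresentedGroup.toGroup.of _⟩⟩

theorem blackburnRelations_of :
    BlackburnRelations (PresentedGroup.of 0 : BlackburnGroup) (PresentedGroup.of 1)
      (PresentedGroup.of 2) := by
  have h : ∀ r ∈ blackburnRels, PresentedGroup.mk blackburnRels r = 1 :=
    fun r => PresentedGroup.one_of_mem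
  constructor
  · exact h _ (Or.inl rfl)
  · exact h _ (Or.inr (Or.inl rfl))
  · exact h _ (Or.inr (Or.inr (Or.inl rfl)))
  · exact h _ (Or.inr (Or.inr (Or.inr (Or.inl rfl))))
  · exact h _ (Or.inr (Or.inr (Or.inr (Or.inr (Or.inl rfl)))))
  · exact h _ (Or.inr (Or.inr (Or.inr (Or.inr (Or.inr rfl)))))

theorem generatingTriple_of :
    GeneratingTriple (PresentedGroup.of 0 : BlackburnGroup) (PresentedGroup.of 1)
      (PresentedGroup.of 2) := by
  rw [GeneratingTriple, ← PresentedGroup.closure_range_of blackburnRels]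
  congr 1
  ext g
  simp [Fin.exists_fin_succ, eq_comm]

theorem CommutesUpTo.pow_left {H : Type*} [Group H] {s u v : H} (h : CommutesUpTo s u v) (k : ℕ) :
    CommutesUpTo (s ^ k) (u ^ k) v := by
  induction k with
  | zero => simpa using commutesUpTo_one.2 (Commute.one_left v)
  | succ k ih => simpa only [pow_succ] using ih.mul_left h

/-- Elements satisfying the relations generate a group of order at most `32`. -/
theorem BlackburnRelations.exists_eq_mul {H : Type*} [Group H] {a b c : H}
    (h : BlackburnRelations a b c) (hg : GeneratingTriple a b c) (g : H) :
    ∃ (i : Fin 4) (j : Fin 4) (k : Fin 2), g = a ^ (i : ℕ) * b ^ (j : ℕ) * c ^ (k : ℕ) := by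
  have hab := commute_of_rel h.comm
  have hc2 : c ^ 2 = a ^ 2 := mul_inv_eq_one.1 h.c_sq
  have hac : c⁻¹ * a * c = a * b ^ 2 := mul_inv_eq_one.1 h.conj_a
  have hbc : c⁻¹ * b * c = b * a ^ 2 := mul_inv_eq_one.1 h.conj_b
  have ha4 : (a ^ 2) * (a ^ 2) = 1 := by rw [← pow_add, h.a_pow]
  have hb4 : (b ^ 2) * (b ^ 2) = 1 := by rw [← pow_add, h.b_pow]
  have hca2 : Commute c (a ^ 2) := hc2 ▸ (Commute.refl c).pow_right 2
  have hcb2 : Commute c (b ^ 2) := by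
    have h1 : c⁻¹ * b ^ 2 * c = b ^ 2 := by
      calc c⁻¹ * b ^ 2 * c = (c⁻¹ * b * c) * (c⁻¹ * b * c) := by simp [pow_two, mul_assoc]
        _ = b ^ 2 := by
          rw [hbc, ← pow_two, (hab.symm.pow_right 2).mul_pow, pow_two (a ^ 2), ha4, mul_one]
    rw [mul_assoc, inv_mul_eq_iff_eq_mul] at h1
    exact h1.symm
  have ha2 : a ^ 2 ∈ Subgroup.center H :=
    hg.mem_center ((Commute.refl a).pow_right 2) (hab.symm.pow_right 2) hca2
  have hb2 : b ^ 2 ∈ Subgroup.center H :=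
    hg.mem_center (hab.pow_right 2) ((Commute.refl b).pow_right 2) hcb2
  have hac' : CommutesUpTo (b ^ 2) c a := by
    have h1 : CommutesUpTo (b ^ 2) a c := ⟨hb2, by
      rw [mul_assoc, inv_mul_eq_iff_eq_mul, ← mul_assoc, Subgroup.mem_center_iff.1 hb2] at hac
      exact hac⟩
    have h2 := h1.symm
    rwa [inv_eq_of_mul_eq_one_left hb4] at h2
  have hbc' : CommutesUpTo (a ^ 2) c b := by
    have h1 : CommutesUpTo (a ^ 2) b c := ⟨ha2, by
      rw [mul_assoc, inv_mul_eq_iff_eq_mul, ← mul_assoc, Subgroup.mem_center_iff.1 ha2] at hbc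
      exact hbc⟩
    have h2 := h1.symm
    rwa [inv_eq_of_mul_eq_one_left ha4] at h2
  -- Moving a past cᵏ costs the central factor b²ᵏ, and moving b past it costs a²ᵏ; this explains
  -- the new exponents.
  have key : ∀ x ∈ ({a, b, c} : Set H), ∀ g, (∃ i j k : ℕ, g = a ^ i * b ^ j * c ^ k) →
      ∃ i j k : ℕ, g * x = a ^ i * b ^ j * c ^ k := by
    rintro x (rfl | rfl | rfl) g ⟨i, j, k, rfl⟩
    · refine ⟨i + 1, j + 2 * k, k, ?_⟩
      rw [mul_assoc, (hac'.pow_left k).2, ← pow_mul, ← mul_assoc (b ^ (2 * k)),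
        (hab.symm.pow_left (2 * k)).eq, pow_succ, pow_add]
      simp only [← mul_assoc]
      rw [mul_assoc (x ^ i) (b ^ j) x, (hab.symm.pow_left j).eq, ← mul_assoc]
    · refine ⟨i + 2 * k, j + 1, k, ?_⟩
      rw [mul_assoc, (hbc'.pow_left k).2, ← pow_mul, pow_succ, pow_add]
      simp only [← mul_assoc]
      rw [mul_assoc (a ^ i) (x ^ j), (hab.symm.pow_pow j (2 * k)).eq, ← mul_assoc]
    · exact ⟨i, j, k + 1, by rw [pow_succ, mul_assoc]⟩
  have hinv : ∀ x ∈ ({a, b, c} : Set H), x⁻¹ = x * x * x := by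
    have h1 : ∀ x : H, x ^ 4 = 1 → x⁻¹ = x * x * x := fun x hx => by
      rw [inv_eq_iff_mul_eq_one, ← hx]
      simp only [pow_succ, pow_zero, one_mul, mul_assoc]
    rintro x (rfl | rfl | rfl)
    · exact h1 _ h.a_pow
    · exact h1 _ h.b_pow
    · exact h1 _ (by rw [show 4 = 2 * 2 from rfl, pow_mul, hc2, pow_two, ha4])
  have main : ∃ i j k : ℕ, g = a ^ i * b ^ j * c ^ k := by
    have hgm : g ∈ Subgroup.closure {a, b, c} := by
      rw [show Subgroup.closure {a, b, c} = ⊤ from hg]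
      exact Subgroup.mem_top g
    induction hgm using Subgroup.closure_induction_right with
    | one => exact ⟨0, 0, 0, by simp⟩
    | mul_right g _ x hx ih => exact key x hx g ih
    | mul_inv_cancel g _ x hx ih =>
      rw [hinv x hx, ← mul_assoc, ← mul_assoc]
      exact key x hx _ (key x hx _ (key x hx _ ih))
  obtain ⟨i, j, k, rfl⟩ := main
  -- Pairs of c are absorbed into the exponent of a by c² = a².
  refine ⟨⟨(i + 2 * (k / 2)) % 4, Nat.mod_lt _ (by norm_num)⟩, ⟨j % 4, Nat.mod_lt _ (by norm_num)⟩,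
    ⟨k % 2, Nat.mod_lt _ (by norm_num)⟩, ?_⟩
  simp only
  rw [← pow_eq_pow_mod _ h.a_pow, ← pow_eq_pow_mod _ h.b_pow]
  conv_lhs => rw [← Nat.div_add_mod k 2, pow_add, pow_mul, hc2, ← pow_mul, ← mul_assoc,
    mul_assoc (a ^ i), (hab.symm.pow_pow j (2 * (k / 2))).eq, ← mul_assoc, ← pow_add]

instance finite_blackburnGroup : Finite BlackburnGroup :=
  Finite.of_surjective (fun p : Fin 4 × Fin 4 × Fin 2 =>
      (PresentedGroup.of 0 : BlackburnGroup) ^ (p.1 : ℕ) * PresentedGroup.of 1 ^ (p.2.1 : ℕ) *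
        PresentedGroup.of 2 ^ (p.2.2 : ℕ)) fun g => by
    obtain ⟨i, j, k, h⟩ := blackburnRelations_of.exists_eq_mul generatingTriple_of g
    exact ⟨(i, j, k), h.symm⟩

theorem card_blackburnGroup_le : Nat.card BlackburnGroup ≤ 32 := by
  have h := Nat.card_le_card_of_surjective (fun p : Fin 4 × Fin 4 × Fin 2 =>
      (PresentedGroup.of 0 : BlackburnGroup) ^ (p.1 : ℕ) * PresentedGroup.of 1 ^ (p.2.1 : ℕ) *
        PresentedGroup.of 2 ^ (p.2.2 : ℕ)) fun g => by
    obtain ⟨i, j, k, h⟩ := blackburnRelations_of.exists_eq_mul generatingTriple_of g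
    exact ⟨(i, j, k), h.symm⟩
  simpa [Nat.card_eq_fintype_card] using h

/-- A concrete group of order `32`: the central extension of `C₂ ^ 3` by `C₂ ^ 2` given by a
bilinear cocycle. -/
@[ext]
structure BlackburnModel where
  /-- the coordinates modulo the centre -/
  (x y z : ZMod 2)
  /-- the central coordinates -/
  (s t : ZMod 2)
  deriving DecidableEq, Fintype

namespace BlackburnModel

/-- The cocycle is read off the relations: with s = a² and t = b², its terms encode a² = c² = [b, c]
= s and b² = [a, c] = t. -/
instance : Mul BlackburnModel :=
  ⟨fun g h => ⟨g.x + h.x, g.y + h.y, g.z + h.z, g.s + h.s + (g.x * h.x + g.z * h.z + g.y * h.z),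
    g.t + h.t + (g.y * h.y + g.x * h.z)⟩⟩

instance : One BlackburnModel :=
  ⟨⟨0, 0, 0, 0, 0⟩⟩

instance : Inv BlackburnModel :=
  ⟨fun g => ⟨-g.x, -g.y, -g.z, -g.s + (g.x * g.x + g.z * g.z + g.y * g.z),
    -g.t + (g.y * g.y + g.x * g.z)⟩⟩

theorem mul_def (x y z s t x' y' z' s' t' : ZMod 2) :
    mk x y z s t * mk x' y' z' s' t' =
      mk (x + x') (y + y') (z + z') (s + s' + (x * x' + z * z' + y * z'))
        (t + t' + (y * y' + x * z')) :=
  rfl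

instance : Group BlackburnModel :=
  Group.ofLeftAxioms
    (by
      rintro ⟨x, y, z, s, t⟩ ⟨x', y', z', s', t'⟩ ⟨x'', y'', z'', s'', t''⟩
      simp only [mul_def, mk.injEq]
      refine ⟨?_, ?_, ?_, ?_, ?_⟩ <;> ring)
    (by decide) (by decide)

theorem card : Nat.card BlackburnModel = 32 := by
  rw [Nat.card_eq_fintype_card]
  decide

/-- The first generator of the model. -/
def a : BlackburnModel := ⟨1, 0, 0, 0, 0⟩

/-- The second generator of the model. -/
def b : BlackburnModel := ⟨0, 1, 0, 0, 0⟩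

/-- The third generator of the model. -/
def c : BlackburnModel := ⟨0, 0, 1, 0, 0⟩

theorem blackburnRelations : BlackburnRelations a b c := by
  constructor <;> decide

theorem generatingTriple : GeneratingTriple a b c := by
  rw [GeneratingTriple, eq_top_iff]
  have h2 : ∀ g : BlackburnModel, ∃ (i : Fin 4) (j : Fin 4) (k : Fin 2),
      g = a ^ (i : ℕ) * b ^ (j : ℕ) * c ^ (k : ℕ) := by decide
  intro g _
  obtain ⟨i, j, k, rfl⟩ := h2 g
  have ⟨hx, hy, hw⟩ := mem_closure_triple a b c
  exact mul_mem (mul_mem (pow_mem hx _) (pow_mem hy _)) (pow_mem hw _)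

end BlackburnModel

/-- The normal form bounds the order above; the surjection onto the model bounds it below. -/
theorem card_blackburnGroup : Nat.card BlackburnGroup = 2 ^ 5 := by
  refine le_antisymm card_blackburnGroup_le ?_
  have h := BlackburnModel.blackburnRelations
  have hs : Function.Surjective h.lift := MonoidHom.range_eq_top.1 <|
    BlackburnModel.generatingTriple.le h.mem_range_lift.1 h.mem_range_lift.2.1
      h.mem_range_lift.2.2
  exact BlackburnModel.card.ge.trans (Nat.card_le_card_of_surjective _ hs)

end Presentation

/-! ### From d-maximality to the classification -/

section Classification

theorem isCritical_of_isDMaximal {G : Type*} [Group G] [Finite G] (hp : IsPGroup 2 G)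
    (hd : IsDMaximal G) (h3 : Group.rank G = 3) : IsCritical G where
  isPGroup := hp
  exists_triple := by
    classical
    obtain ⟨S, hS, hS'⟩ := Group.rank_spec G
    obtain ⟨x, y, w, -, -, -, h⟩ := Finset.card_eq_three.1 (hS.trans h3)
    exact ⟨x, y, w, by simpa [h, GeneratingTriple] using hS'⟩
  closure_pair_ne_top x y h := by
    classical
    have h1 := Group.rank_le (S := ({x, y} : Finset G)) (by simpa using h)
    have h2 : ({x, y} : Finset G).card ≤ 2 := Finset.card_le_two
    omega
  exists_pair H hH := by
    have h1 := hd H (lt_top_iff_ne_top.2 hH)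
    obtain ⟨S, hS, hS'⟩ := Group.rank_spec H
    -- Adjoining 1 allows a generating set with fewer than two elements to be padded to a pair.
    obtain ⟨x, y, hxy⟩ : ∃ x y : H, (S : Set H) ∪ {1} = {x, y} ∪ {1} := by
      have hS2 : S.card = 0 ∨ S.card = 1 ∨ S.card = 2 := by omega
      rcases hS2 with h | h | h
      · exact ⟨1, 1, by simp [Finset.card_eq_zero.1 h]⟩
      · obtain ⟨x, rfl⟩ := Finset.card_eq_one.1 h
        exact ⟨x, x, by simp⟩
      · classical
        obtain ⟨x, y, -, rfl⟩ := Finset.card_eq_two.1 h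
        exact ⟨x, y, by simp⟩
    have h2 : Subgroup.closure {x, y} = ⊤ := by
      rw [← hS', ← Subgroup.closure_union_one, ← hxy, Subgroup.closure_union_one]
    refine ⟨x, y, ?_⟩
    have h4 := MonoidHom.map_closure H.subtype {x, y}
    rw [h2, ← MonoidHom.range_eq_map, Subgroup.range_subtype, Set.image_pair] at h4
    exact h4.symm

variable {G : Type*} [Group G] [Finite G]

theorem IsCritical.classification (hG : IsCritical G) :
    Nonempty (G ≃* Cyc 2 × Cyc 2 × Cyc 2) ∨ Nonempty (G ≃* Cyc 2 × QuaternionGroup 2) ∨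
      Nonempty (G ≃* C4Q8) ∨ Nonempty (G ≃* BlackburnGroup) := by
  have h8 := hG.eight_mul_card_squares_le
  rcases hG.card_squares_cases with hc | hc | hc <;> rw [hc] at h8
  · obtain ⟨x, y, w, h⟩ := hG.exists_triple
    have h2 : ∀ g : G, g ^ 2 = 1 := fun g =>
      Subgroup.mem_bot.1 (Subgroup.eq_bot_of_card_eq _ hc ▸ sq_mem_squares g)
    have hcomm := mul_comm_of_exponent_two h2
    exact Or.inl (nonempty_mulEquiv_elementary h (h2 x) (h2 y) (h2 w) (hcomm x y) (hcomm x w)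
      (hcomm y w) h8)
  · obtain ⟨f, x, y, w, h, -, -, hf, hxw, hyw, hx, hy, hxy, hw | hw⟩ :=
      hG.exists_of_card_squares_eq_two hc
    · exact Or.inr (Or.inl (nonempty_mulEquiv_cyc_prod_quaternion h hf hx hy hxy hw hxw hyw h8))
    · exact Or.inr (Or.inr (Or.inl (nonempty_mulEquiv_C4Q8 h hf hx hy hxy hw hxw hyw h8)))
  · obtain ⟨a, b, c, h, hab, hca, ha4, hb4, hac, hbc, -⟩ := hG.exists_of_card_squares_eq_four hc
    have hconj : ∀ {u s : G}, CommutesUpTo s u c → c⁻¹ * u * c * (u * s)⁻¹ = 1 :=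
      fun {u s} hu => by
        rw [mul_inv_eq_one, mul_assoc, hu.2, inv_mul_eq_iff_eq_mul,
          Subgroup.mem_center_iff.1 hu.1 u, ← mul_assoc, ← mul_assoc,
          Subgroup.mem_center_iff.1 hu.1 c]
    have hrel : BlackburnRelations a b c :=
      { a_pow := by rw [show 4 = 2 * 2 from rfl, pow_mul, ha4]
        b_pow := by rw [show 4 = 2 * 2 from rfl, pow_mul, hb4]
        comm := by simp [hab.eq]
        c_sq := mul_inv_eq_one.2 hca
        conj_a := hconj hac
        conj_b := hconj hbc }
    obtain ⟨h1, h2, h3⟩ := hrel.mem_range_lift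
    exact Or.inr (Or.inr (Or.inr
      (nonempty_mulEquiv_of_card_le hrel.lift h h1 h2 h3 (card_blackburnGroup.trans_le h8))))

end Classification

end ThreeGenerated

theorem mainTheorem6 :
    (∀ (G : Type*) [Group G] [Finite G],
      IsPGroup 2 G → IsDMaximal G → Group.rank G = 3 →
        Nonempty (G ≃* Cyc 2 × Cyc 2 × Cyc 2) ∨
        Nonempty (G ≃* Cyc 2 × QuaternionGroup 2) ∨
        Nonempty (G ≃* C4Q8) ∨
        Nonempty (G ≃* BlackburnGroup)) ∧
    Nonempty (C4Q8 ≃* C4D8) ∧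
    Nat.card C4Q8 = 2 ^ 4 ∧
    Nat.card BlackburnGroup = 2 ^ 5 :=
  ⟨fun _ _ _ hp hd h3 => (ThreeGenerated.isCritical_of_isDMaximal hp hd h3).classification,
    ThreeGenerated.nonempty_C4Q8_mulEquiv_C4D8, ThreeGenerated.card_C4Q8,
    ThreeGenerated.card_blackburnGroup⟩
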